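/- Identify $\mathbb{R}^2$ with $\mathbb{C}$ through $z = x_1 + i x_2$, and let $\partial_{\overline{z}} = \frac12\left(\partial_{x_1} + i\,\partial_{x_2}\right)$. Let $2 < p < \infty$, and let $a \in L^2(\mathbb{R}^2)$ and $u \in L^p(\mathbb{R}^2)$ be complex-valued. If $\partial_{\overline{z}} u = a\,\overline{u}$ in the sense of distributions on $\mathbb{R}^2$, then $u = 0$ (almost everywhere). -/

import Mathlib

open MeasureTheory
open scoped ENNReal ComplexConjugate Distributions LineDeriv

/-- The complex-valued distribution `φ ↦ ∫ φ f` on `ℂ = ℝ²` given by a locally integrable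
function `f` (as usual in Mathlib, it is `0` when `f` is not locally integrable). -/
noncomputable def distOfFun (f : ℂ → ℂ) : 𝓓'((⊤ : TopologicalSpace.Opens ℂ), ℂ) :=
  ContinuousLinearMap.toUniformConvergenceCLM (RingHom.id ℝ) ℂ _
    (TestFunction.integralAgainstBilinCLM (ContinuousLinearMap.lsmul ℝ ℝ : ℝ →L[ℝ] ℂ →L[ℝ] ℂ)
      (volume : Measure ℂ) f)

/-- The operator `∂̄ = (1/2) (∂₁ + i ∂₂)` on distributions on `ℂ = ℝ²`, where `∂₁` and `∂₂` are
the distributional derivatives along the coordinate vectors `1` and `i`. -/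
noncomputable def dbar (T : 𝓓'((⊤ : TopologicalSpace.Opens ℂ), ℂ)) :
    𝓓'((⊤ : TopologicalSpace.Opens ℂ), ℂ) :=
  (1 / 2 : ℂ) • (∂_{(1 : ℂ)} T + Complex.I • ∂_{Complex.I} T)

/-! Setting `q = a * conj u / u` turns the real-linear equation into the complex-linear one `∂̄ u =
q u`, with `|q| ≤ |a|` and hence `q ∈ L²`. If the `L²` norm of `q` were small, one would invert `∂̄`
by the Cauchy transform `C`: the Hardy–Littlewood–Sobolev inequality and Hölder give `‖C(q u)‖_p ≤ K
‖q‖₂ ‖u‖_p`, a contraction, which forces `u = 0`. For general `q`, choose a smooth compactly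
supported `g` with `‖q - g‖₂` small and put `v = exp(-C g) u`. Since `∂̄ (C g) = g`, formally `∂̄ v
= (q - g) v`; since `C g` is bounded, `v` stays in `L^p`, and the contraction applies to `v`. The
ingredients are `exists_lintegral_cauchyPot_mul_rpow_le` (the estimate), `cauchyTransform_dbarFun`
(the fundamental solution), and `integral_mul_gauge`, which proves `v = C((q - g) v)` in weak form.
The last tests the equation with `exp(-C g) χₙ C ψ`; the cutoffs `χₙ` can be removed because their
`∂̄` derivative and `C ψ` both decay like `1/(1 + |z|)`. -/

/-! ### The distributional equation in integral form. -/

/-- The pointwise `∂̄` derivative of a function on `ℂ = ℝ²`. -/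
noncomputable def dbarFun (φ : ℂ → ℂ) (z : ℂ) : ℂ :=
  (1 / 2 : ℂ) * (fderiv ℝ φ z 1 + Complex.I * fderiv ℝ φ z Complex.I)

theorem distOfFun_apply {f : ℂ → ℂ} (hf : LocallyIntegrable f)
    (φ : 𝓓((⊤ : TopologicalSpace.Opens ℂ), ℝ)) :
    distOfFun f φ = ∫ z, (φ z : ℂ) * f z := by
  have h : LocallyIntegrableOn f ((⊤ : TopologicalSpace.Opens ℂ) : Set ℂ) volume :=
    hf.locallyIntegrableOn _
  refine (TestFunction.integralAgainstBilinCLM_eq_integral h).trans ?_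
  simp

theorem dbar_distOfFun_apply {f : ℂ → ℂ} (hf : LocallyIntegrable f)
    (φ : 𝓓((⊤ : TopologicalSpace.Opens ℂ), ℝ)) :
    dbar (distOfFun f) φ = -((1 / 2 : ℂ) * ((∫ z, ((fderiv ℝ φ z 1 : ℝ) : ℂ) * f z) +
      Complex.I * ∫ z, ((fderiv ℝ φ z Complex.I : ℝ) : ℂ) * f z)) := by
  have key : ∀ v : ℂ, (∂_{v} (distOfFun f)) φ = -∫ z, ((fderiv ℝ φ z v : ℝ) : ℂ) * f z := by
    intro v
    rw [Distribution.lineDerivOp_apply_apply, map_neg, distOfFun_apply hf]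
    congr 1
  change (1 / 2 : ℂ) • ((∂_{(1 : ℂ)} (distOfFun f)) φ
    + Complex.I • (∂_{Complex.I} (distOfFun f)) φ) = _
  rw [key, key, smul_eq_mul, smul_eq_mul]
  ring

theorem integrable_mul_of_hasCompactSupport {f φ : ℂ → ℂ} (hf : LocallyIntegrable f)
    (hφ : Continuous φ) (hφc : HasCompactSupport φ) : Integrable fun z => f z * φ z := by
  simpa [mul_comm] using hf.integrable_smul_left_of_hasCompactSupport hφ hφc

theorem integral_mul_dbarFun_ofReal {u g : ℂ → ℂ} (hu : LocallyIntegrable u)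
    (hg : LocallyIntegrable g) (h : dbar (distOfFun u) = distOfFun g) {φ : ℂ → ℝ}
    (hφ : ContDiff ℝ (⊤ : ℕ∞) φ) (hφc : HasCompactSupport φ) :
    ∫ z, u z * ((1 / 2 : ℂ) * ((fderiv ℝ φ z 1 : ℝ) + Complex.I * (fderiv ℝ φ z Complex.I : ℝ))) =
      -∫ z, g z * φ z := by
  let f : 𝓓((⊤ : TopologicalSpace.Opens ℂ), ℝ) := ⟨φ, hφ, hφc, by simp⟩
  have hf : ∀ v : ℂ, Integrable fun z => ((fderiv ℝ φ z v : ℝ) : ℂ) * u z := by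
    intro v
    have h1 : Continuous fun z => ((fderiv ℝ φ z v : ℝ) : ℂ) :=
      Complex.continuous_ofReal.comp ((hφ.continuous_fderiv (by simp)).clm_apply continuous_const)
    have h2 : HasCompactSupport fun z => ((fderiv ℝ φ z v : ℝ) : ℂ) :=
      (hφc.fderiv_apply ℝ v).comp_left (g := fun x : ℝ => (x : ℂ)) (by simp)
    simpa [mul_comm] using integrable_mul_of_hasCompactSupport hu h1 h2
  have key := dbar_distOfFun_apply hu f
  rw [h, distOfFun_apply hg] at key
  rw [eq_comm, ← sub_eq_zero] at key
  change -((1 / 2 : ℂ) * ((∫ z, ((fderiv ℝ φ z 1 : ℝ) : ℂ) * u z) +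
      Complex.I * ∫ z, ((fderiv ℝ φ z Complex.I : ℝ) : ℂ) * u z)) - ∫ z, (φ z : ℂ) * g z = 0 at key
  rw [← integral_const_mul, ← integral_add (hf _) ((hf _).const_mul _),
    ← integral_const_mul] at key
  have e1 : ∫ z, u z * ((1 / 2 : ℂ) *
      ((fderiv ℝ φ z 1 : ℝ) + Complex.I * (fderiv ℝ φ z Complex.I : ℝ))) =
      ∫ z, (1 / 2 : ℂ) * (((fderiv ℝ φ z 1 : ℝ) : ℂ) * u z +
        Complex.I * (((fderiv ℝ φ z Complex.I : ℝ) : ℂ) * u z)) :=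
    integral_congr_ae (.of_forall fun z => by ring)
  have e2 : ∫ z, g z * φ z = ∫ z, (φ z : ℂ) * g z :=
    integral_congr_ae (.of_forall fun z => by ring)
  rw [e1, e2]
  linear_combination -key

theorem continuous_dbarFun {φ : ℂ → ℂ} (hφ : ContDiff ℝ 1 φ) : Continuous (dbarFun φ) := by
  have h := hφ.continuous_fderiv (by simp)
  exact continuous_const.mul ((h.clm_apply continuous_const).add
    (continuous_const.mul (h.clm_apply continuous_const)))

theorem hasCompactSupport_dbarFun {φ : ℂ → ℂ} (hφ : HasCompactSupport φ) :
    HasCompactSupport (dbarFun φ) :=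
  HasCompactSupport.mul_left ((hφ.fderiv_apply ℝ (1 : ℂ)).add
    (HasCompactSupport.mul_left (hφ.fderiv_apply ℝ Complex.I)))

/-- A distributional equation `∂̄ u = g` between locally integrable functions, tested against
complex-valued test functions. -/
theorem integral_mul_dbarFun_of_dbar_eq {u g : ℂ → ℂ} (hu : LocallyIntegrable u)
    (hg : LocallyIntegrable g) (h : dbar (distOfFun u) = distOfFun g) {φ : ℂ → ℂ}
    (hφ : ContDiff ℝ (⊤ : ℕ∞) φ) (hφc : HasCompactSupport φ) :
    ∫ z, u z * dbarFun φ z = -∫ z, g z * φ z := by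
  have hd : ∀ z, HasFDerivAt φ (fderiv ℝ φ z) z := fun z =>
    (hφ.differentiable (by simp) z).hasFDerivAt
  -- The test functions of `𝓓` used here are real valued; complex ones are reached by taking `L` to
  -- be the real and the imaginary part and recombining.
  have part : ∀ L : ℂ →L[ℝ] ℝ,
      Integrable (fun z => u z * ((1 / 2 : ℂ) * ((L (fderiv ℝ φ z 1) : ℝ)
        + Complex.I * (L (fderiv ℝ φ z Complex.I) : ℝ)))) ∧
      Integrable (fun z => g z * (L (φ z) : ℂ)) ∧
      ∫ z, u z * ((1 / 2 : ℂ) * ((L (fderiv ℝ φ z 1) : ℝ)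
        + Complex.I * (L (fderiv ℝ φ z Complex.I) : ℝ))) = -∫ z, g z * (L (φ z) : ℂ) := by
    intro L
    have hLφ : ContDiff ℝ (⊤ : ℕ∞) fun z => L (φ z) := L.contDiff.comp hφ
    have hLc : HasCompactSupport fun z => L (φ z) := hφc.comp_left (map_zero L)
    have hcd : ∀ v, Continuous fun z => ((L (fderiv ℝ φ z v) : ℝ) : ℂ) := fun v =>
      Complex.continuous_ofReal.comp
        (L.continuous.comp ((hφ.continuous_fderiv (by simp)).clm_apply continuous_const))
    have hcs : ∀ v, HasCompactSupport fun z => ((L (fderiv ℝ φ z v) : ℝ) : ℂ) := fun v =>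
      (hφc.fderiv_apply ℝ v).comp_left (g := fun x : ℂ => ((L x : ℝ) : ℂ)) (by simp)
    refine ⟨integrable_mul_of_hasCompactSupport hu
        (continuous_const.mul ((hcd 1).add (continuous_const.mul (hcd Complex.I))))
        (HasCompactSupport.mul_left ((hcs 1).add (HasCompactSupport.mul_left (hcs Complex.I)))),
      integrable_mul_of_hasCompactSupport hg (Complex.continuous_ofReal.comp hLφ.continuous)
        (hLc.comp_left (g := fun x : ℝ => (x : ℂ)) (by simp)), ?_⟩
    rw [← integral_mul_dbarFun_ofReal hu hg h hLφ hLc]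
    refine integral_congr_ae (.of_forall fun z => ?_)
    have : fderiv ℝ (fun z => L (φ z)) z = L.comp (fderiv ℝ φ z) :=
      (L.hasFDerivAt.comp z (hd z)).fderiv
    simp [this]
  obtain ⟨i1, i2, i3⟩ := part Complex.reCLM
  obtain ⟨j1, j2, j3⟩ := part Complex.imCLM
  have e1 : ∀ z, u z * dbarFun φ z =
      u z * ((1 / 2 : ℂ) * ((Complex.reCLM (fderiv ℝ φ z 1) : ℝ)
        + Complex.I * (Complex.reCLM (fderiv ℝ φ z Complex.I) : ℝ))) +
      Complex.I * (u z * ((1 / 2 : ℂ) * ((Complex.imCLM (fderiv ℝ φ z 1) : ℝ)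
        + Complex.I * (Complex.imCLM (fderiv ℝ φ z Complex.I) : ℝ)))) := by
    intro z
    simp only [dbarFun, Complex.reCLM_apply, Complex.imCLM_apply]
    conv_lhs => rw [← Complex.re_add_im (fderiv ℝ φ z 1),
      ← Complex.re_add_im (fderiv ℝ φ z Complex.I)]
    ring
  have e2 : ∀ z, g z * φ z = g z * (Complex.reCLM (φ z) : ℂ) +
      Complex.I * (g z * (Complex.imCLM (φ z) : ℂ)) := by
    intro z
    simp only [Complex.reCLM_apply, Complex.imCLM_apply]
    conv_lhs => rw [← Complex.re_add_im (φ z)]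
    ring
  simp_rw [e1, e2]
  rw [integral_add i1 (j1.const_mul _), integral_const_mul, integral_add i2 (j2.const_mul _),
    integral_const_mul, i3, j3]
  ring

/-! ### Radial integrals of the truncated kernels. -/

theorem lintegral_radial {h : ℝ → ℝ≥0∞} (hh : Measurable h) :
    ∫⁻ z : ℂ, h ‖z‖ = ENNReal.ofReal (2 * Real.pi) *
      ∫⁻ r in Set.Ioi (0 : ℝ), ENNReal.ofReal r * h r := by
  rw [← Complex.lintegral_comp_polarCoord_symm]
  have hset : polarCoord.target = Set.Ioi (0 : ℝ) ×ˢ Set.Ioo (-Real.pi) Real.pi := rfl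
  have e : ∫⁻ p in polarCoord.target, ENNReal.ofReal p.1 • h ‖Complex.polarCoord.symm p‖ =
      ∫⁻ p in Set.Ioi (0 : ℝ) ×ˢ Set.Ioo (-Real.pi) Real.pi, ENNReal.ofReal p.1 * h p.1 := by
    rw [hset]
    refine setLIntegral_congr_fun (measurableSet_Ioi.prod measurableSet_Ioo) fun p hp => ?_
    have : (0 : ℝ) < p.1 := hp.1
    simp only [Complex.norm_polarCoord_symm, abs_of_pos this, smul_eq_mul]
  rw [e, Measure.volume_eq_prod, ← Measure.prod_restrict, lintegral_prod _ (by fun_prop)]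
  simp only [lintegral_const, Measure.restrict_apply MeasurableSet.univ, Set.univ_inter,
    Real.volume_Ioo]
  rw [lintegral_mul_const _ (by fun_prop), mul_comm]
  congr 2
  ring

/-- The kernel `1/|z|` cut off to the disc of radius `R`. -/
noncomputable def nearKernel (R : ℝ) (z : ℂ) : ℝ≥0∞ :=
  (Metric.closedBall (0 : ℂ) R).indicator (fun z => ‖z‖ₑ⁻¹) z

/-- The kernel `1/|z|` cut off to the complement of the disc of radius `R`. -/
noncomputable def farKernel (R : ℝ) (z : ℂ) : ℝ≥0∞ :=
  (Metric.closedBall (0 : ℂ) R)ᶜ.indicator (fun z => ‖z‖ₑ⁻¹) z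

theorem measurable_nearKernel (R : ℝ) : Measurable (nearKernel R) :=
  Measurable.indicator (by fun_prop) measurableSet_closedBall

theorem measurable_farKernel (R : ℝ) : Measurable (farKernel R) :=
  Measurable.indicator (by fun_prop) measurableSet_closedBall.compl

theorem nearKernel_add_farKernel (R : ℝ) (z : ℂ) : nearKernel R z + farKernel R z = ‖z‖ₑ⁻¹ :=
  Set.indicator_self_add_compl_apply _ _ _

theorem lintegral_nearKernel (R : ℝ) :
    ∫⁻ z, nearKernel R z = ENNReal.ofReal (2 * Real.pi * R) := by
  have e : ∀ z, nearKernel R z = (Set.Iic R).indicator (fun r : ℝ => (ENNReal.ofReal r)⁻¹) ‖z‖ := by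
    intro z
    by_cases h : ‖z‖ ≤ R <;> simp [nearKernel, h]
  simp_rw [e]
  rw [lintegral_radial (Measurable.indicator (by fun_prop) measurableSet_Iic),
    ENNReal.ofReal_mul (p := 2 * Real.pi) (by positivity)]
  congr 1
  have e2 : ∀ r ∈ Set.Ioi (0 : ℝ), ENNReal.ofReal r *
      (Set.Iic R).indicator (fun r : ℝ => (ENNReal.ofReal r)⁻¹) r =
      (Set.Iic R).indicator (fun _ => 1) r := by
    intro r hr
    by_cases h : r ∈ Set.Iic R
    · simp only [Set.indicator_of_mem h]
      exact ENNReal.mul_inv_cancel (by simpa using hr) (by simp)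
    · simp only [Set.indicator_of_notMem h, mul_zero]
  rw [setLIntegral_congr_fun measurableSet_Ioi e2, lintegral_indicator measurableSet_Iic,
    Measure.restrict_restrict measurableSet_Iic, lintegral_one]
  rw [Set.inter_comm, Set.Ioi_inter_Iic, Measure.restrict_apply_univ, Real.volume_Ioc, sub_zero]

/-- In polar coordinates the integrand becomes `r ^ (1 - q)` on `(R, ∞)`; integrability at infinity
is where `q > 2` enters. -/
theorem lintegral_farKernel_rpow {R q : ℝ} (hR : 0 < R) (hq : 2 < q) :
    ∫⁻ z, farKernel R z ^ q =
      ENNReal.ofReal (2 * Real.pi) * ENNReal.ofReal (R ^ (2 - q) / (q - 2)) := by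
  have e : ∀ z, farKernel R z ^ q =
      (Set.Ioi R).indicator (fun r : ℝ => (ENNReal.ofReal r)⁻¹ ^ q) ‖z‖ := by
    intro z
    by_cases h : R < ‖z‖
    · have h' : ¬ ‖z‖ ≤ R := not_le.2 h
      simp [farKernel, h, h']
    · have h' : ‖z‖ ≤ R := not_lt.1 h
      have : (0 : ℝ) < q := by linarith
      simp [farKernel, h, h', this]
  simp_rw [e]
  rw [lintegral_radial (Measurable.indicator (by fun_prop) measurableSet_Ioi)]
  congr 1
  have e2 : ∀ r ∈ Set.Ioi (0 : ℝ), ENNReal.ofReal r *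
      (Set.Ioi R).indicator (fun r : ℝ => (ENNReal.ofReal r)⁻¹ ^ q) r =
      (Set.Ioi R).indicator (fun r => ENNReal.ofReal (r ^ (1 - q))) r := by
    intro r hr
    have hr' : 0 < r := hr
    by_cases h : r ∈ Set.Ioi R
    · simp only [Set.indicator_of_mem h]
      rw [← ENNReal.ofReal_inv_of_pos hr', ENNReal.ofReal_rpow_of_pos (by positivity),
        ← ENNReal.ofReal_mul hr'.le, Real.inv_rpow hr'.le, Real.rpow_sub hr', Real.rpow_one,
        div_eq_mul_inv]
    · simp only [Set.indicator_of_notMem h, mul_zero]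
  rw [setLIntegral_congr_fun measurableSet_Ioi e2, lintegral_indicator measurableSet_Ioi,
    Measure.restrict_restrict measurableSet_Ioi, Set.Ioi_inter_Ioi, max_eq_left hR.le,
    ← ofReal_integral_eq_lintegral_ofReal (integrableOn_Ioi_rpow_of_lt (by linarith) hR) ?_,
    integral_Ioi_rpow_of_lt (by linarith) hR]
  · congr 1
    rw [show 1 - q + 1 = 2 - q by ring, ← neg_div_neg_eq, neg_neg]
    congr 1
    ring
  · filter_upwards [ae_restrict_mem measurableSet_Ioi] with r hr
    exact Real.rpow_nonneg (hR.le.trans (le_of_lt hr)) _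

/-! ### Layer cake and the Hardy–Littlewood–Sobolev inequality. -/

/-- The layer cake formula for a single value. -/
theorem lintegral_indicator_rpow {α : ℝ} (hα : 0 < α) (x : ℝ≥0∞) :
    ∫⁻ t in Set.Ioi (0 : ℝ), {t : ℝ | ENNReal.ofReal t < x}.indicator
      (fun t => ENNReal.ofReal (t ^ (α - 1))) t = ENNReal.ofReal α⁻¹ * x ^ α := by
  have fin : ∀ c : ℝ, 0 ≤ c → ∫⁻ t in Set.Ioo 0 c, ENNReal.ofReal (t ^ (α - 1)) =
      ENNReal.ofReal α⁻¹ * ENNReal.ofReal c ^ α := by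
    intro c hc
    have hi : IntegrableOn (fun t : ℝ => t ^ (α - 1)) (Set.Ioc 0 c) :=
      (intervalIntegrable_iff_integrableOn_Ioc_of_le hc).1
        (intervalIntegral.intervalIntegrable_rpow' (by linarith))
    rw [setLIntegral_congr Ioo_ae_eq_Ioc, ← ofReal_integral_eq_lintegral_ofReal hi,
      ← intervalIntegral.integral_of_le hc, integral_rpow (Or.inl (by linarith))]
    · rw [sub_add_cancel, Real.zero_rpow hα.ne', sub_zero, ENNReal.ofReal_rpow_of_nonneg hc hα.le,
        ← ENNReal.ofReal_mul (by positivity)]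
      congr 1
      field_simp
    · filter_upwards [ae_restrict_mem measurableSet_Ioc] with r hr
      exact Real.rpow_nonneg hr.1.le _
  have hm : MeasurableSet {t : ℝ | ENNReal.ofReal t < x} :=
    measurableSet_lt (by fun_prop) measurable_const
  rw [lintegral_indicator hm, Measure.restrict_restrict hm]
  rcases eq_or_ne x ∞ with rfl | hx
  · rw [ENNReal.top_rpow_of_pos hα, ENNReal.mul_top (by simpa using hα), eq_top_iff]
    refine ENNReal.le_of_forall_nnreal_lt fun c _ => ?_
    -- This endpoint makes the truncated integral exactly `c`, and `c` is arbitrary.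
    have h1 := fin ((α * c) ^ α⁻¹) (by positivity)
    rw [ENNReal.ofReal_rpow_of_nonneg (by positivity) hα.le, ← Real.rpow_mul (by positivity),
      inv_mul_cancel₀ hα.ne', Real.rpow_one, ← ENNReal.ofReal_mul (by positivity),
      inv_mul_cancel_left₀ hα.ne', ENNReal.ofReal_coe_nnreal] at h1
    rw [← h1]
    exact lintegral_mono_set fun t ht => ⟨by simp, ht.1⟩
  · have : {t : ℝ | ENNReal.ofReal t < x} ∩ Set.Ioi 0 = Set.Ioo 0 x.toReal := by
      ext t
      simp only [Set.mem_inter_iff, Set.mem_ofPred_eq, Set.mem_Ioi, Set.mem_Ioo]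
      constructor
      · rintro ⟨h1, h2⟩
        exact ⟨h2, (ENNReal.ofReal_lt_iff_lt_toReal h2.le hx).1 h1⟩
      · rintro ⟨h2, h1⟩
        exact ⟨(ENNReal.ofReal_lt_iff_lt_toReal h2.le hx).2 h1, h2⟩
    rw [this, fin _ ENNReal.toReal_nonneg, ENNReal.ofReal_toReal hx]

/-- The Riesz potential of order one of a nonnegative function on `ℂ`, up to normalisation. -/
noncomputable def cauchyPot (f : ℂ → ℝ≥0∞) (z : ℂ) : ℝ≥0∞ :=
  ∫⁻ w, ‖z - w‖ₑ⁻¹ * f w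

theorem measurable_cauchyPot {f : ℂ → ℝ≥0∞} (hf : Measurable f) : Measurable (cauchyPot f) :=
  Measurable.lintegral_prod_right' (f := fun x : ℂ × ℂ => ‖x.1 - x.2‖ₑ⁻¹ * f x.2) (by fun_prop)

/-- Hölder with the exponent `2p/(p-2) > 2` conjugate to `2p/(p+2)`. The radius `t ^ (-p/2)` is the
one for which the bound is linear in `t`. -/
theorem lintegral_farKernel_mul_le {p : ℝ} (hp : 2 < p) {f : ℂ → ℝ≥0∞} (hf : Measurable f)
    (hf1 : ∫⁻ w, f w ^ (2 * p / (p + 2)) ≤ 1) {t : ℝ} (ht : 0 < t) (z : ℂ) :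
    ∫⁻ w, farKernel (t ^ (-p / 2)) (z - w) * f w ≤
      ENNReal.ofReal ((2 * Real.pi / (2 * p / (p - 2) - 2)) ^ ((p - 2) / (2 * p)) * t) := by
  have h2 : 0 < p - 2 := by linarith
  set q := 2 * p / (p - 2) with hq
  have hq2 : 2 < q := by rw [hq, lt_div_iff₀ h2]; linarith
  have hconj : q.HolderConjugate (2 * p / (p + 2)) := by
    rw [Real.holderConjugate_iff]
    refine ⟨by linarith, ?_⟩
    rw [hq]
    field_simp
    ring
  have hR : 0 < t ^ (-p / 2) := Real.rpow_pos_of_pos ht _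
  refine (ENNReal.lintegral_mul_le_Lp_mul_Lq volume hconj
    (f := fun w => farKernel (t ^ (-p / 2)) (z - w))
    ((measurable_farKernel _).comp (by fun_prop)).aemeasurable hf.aemeasurable).trans ?_
  have e : ∫⁻ w, farKernel (t ^ (-p / 2)) (z - w) ^ q =
      ∫⁻ w, farKernel (t ^ (-p / 2)) w ^ q :=
    lintegral_sub_left_eq_self (fun w => farKernel (t ^ (-p / 2)) w ^ q) z
  have h1 : (∫⁻ w, f w ^ (2 * p / (p + 2))) ^ (1 / (2 * p / (p + 2))) ≤ 1 := by
    refine ENNReal.rpow_le_one hf1 (by positivity)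
  refine (mul_le_mul_right h1 _).trans ?_
  have hexp : ((t ^ (-p / 2)) ^ (2 - q)) ^ ((p - 2) / (2 * p)) = t := by
    rw [← Real.rpow_mul ht.le, ← Real.rpow_mul ht.le]
    conv_rhs => rw [← Real.rpow_one t]
    congr 1
    rw [hq]
    field_simp
    ring
  have hq20 : 0 < q - 2 := by linarith
  simp only [mul_one]
  rw [e, lintegral_farKernel_rpow hR hq2, ← ENNReal.ofReal_mul (by positivity),
    ENNReal.ofReal_rpow_of_nonneg (by positivity) (by positivity)]
  refine ENNReal.ofReal_le_ofReal (le_of_eq ?_)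
  rw [show 1 / q = (p - 2) / (2 * p) by rw [hq]; field_simp]
  rw [← mul_div_assoc, mul_comm (2 * Real.pi), mul_div_assoc,
    Real.mul_rpow (by positivity) (by positivity), hexp, mul_comm]

/-- The kernel is cut at radius `R = t ^ (-p/2)` and `f` at height `s = t ^ (1 + p/2)`. Since `R * s
= t`, the near part of the kernel against values of `f` up to `s` contributes at most `2πt`, and the
far part is also `O(t)`. Only near kernel against large values of `f` remains. -/
theorem cauchyPot_le_near {p : ℝ} (hp : 2 < p) {f : ℂ → ℝ≥0∞} (hf : Measurable f)
    (hf1 : ∫⁻ w, f w ^ (2 * p / (p + 2)) ≤ 1) {t : ℝ} (ht : 0 < t) (z : ℂ) :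
    cauchyPot f z ≤ ENNReal.ofReal
        (((2 * Real.pi / (2 * p / (p - 2) - 2)) ^ ((p - 2) / (2 * p)) + 2 * Real.pi) * t) +
      ∫⁻ w, nearKernel (t ^ (-p / 2)) (z - w) *
        {w | ENNReal.ofReal (t ^ (1 + p / 2)) < f w}.indicator f w := by
  set R := t ^ (-p / 2) with hRdef
  set s := t ^ (1 + p / 2) with hsdef
  have h2 : 0 < p - 2 := by linarith
  have hR : 0 < R := Real.rpow_pos_of_pos ht _
  have hq2 : 0 < 2 * p / (p - 2) - 2 := by
    rw [sub_pos, lt_div_iff₀ h2]; linarith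
  have hset : MeasurableSet {w | ENNReal.ofReal s < f w} := measurableSet_lt measurable_const hf
  have hnear : Measurable fun w => nearKernel R (z - w) :=
    (measurable_nearKernel R).comp (by fun_prop)
  have hfar : Measurable fun w => farKernel R (z - w) :=
    (measurable_farKernel R).comp (by fun_prop)
  have key : ∀ w, ‖z - w‖ₑ⁻¹ * f w ≤ farKernel R (z - w) * f w +
      nearKernel R (z - w) * ENNReal.ofReal s +
      nearKernel R (z - w) * {w | ENNReal.ofReal s < f w}.indicator f w := by
    intro w
    rw [← nearKernel_add_farKernel R, add_mul, add_comm, add_assoc, ← mul_add]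
    gcongr
    by_cases h : ENNReal.ofReal s < f w
    · rw [Set.indicator_of_mem (by exact h)]
      exact le_add_self
    · exact (not_lt.1 h).trans le_self_add
  refine (lintegral_mono key).trans ?_
  rw [lintegral_add_left (by fun_prop), lintegral_add_left (by fun_prop)]
  gcongr
  rw [lintegral_mul_const _ hnear,
    lintegral_sub_left_eq_self (fun w => nearKernel R w) z, lintegral_nearKernel,
    add_mul, ENNReal.ofReal_add (by positivity) (by positivity)]
  refine add_le_add (lintegral_farKernel_mul_le hp hf hf1 ht z) ?_
  rw [← ENNReal.ofReal_mul (by positivity)]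
  refine ENNReal.ofReal_le_ofReal (le_of_eq ?_)
  rw [mul_assoc, hRdef, hsdef, ← Real.rpow_add ht, show -p / 2 + (1 + p / 2) = 1 by ring,
    Real.rpow_one]

theorem lintegral_lintegral_nearKernel (R : ℝ) {g : ℂ → ℝ≥0∞} (hg : Measurable g) :
    ∫⁻ z, ∫⁻ w, nearKernel R (z - w) * g w = ENNReal.ofReal (2 * Real.pi * R) * ∫⁻ w, g w := by
  have hm : Measurable fun x : ℂ × ℂ => nearKernel R (x.1 - x.2) * g x.2 :=
    ((measurable_nearKernel R).comp (by fun_prop)).mul (by fun_prop)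
  rw [lintegral_lintegral_swap hm.aemeasurable, ← lintegral_const_mul _ hg]
  refine lintegral_congr fun w => ?_
  have hmw : Measurable fun z => nearKernel R (z - w) :=
    (measurable_nearKernel R).comp (by fun_prop)
  rw [lintegral_mul_const _ hmw,
    lintegral_sub_right_eq_self (fun z => nearKernel R z) w, lintegral_nearKernel]

/-- The constant in the level set estimate for `cauchyPot`. -/
noncomputable def levelConst (p : ℝ) : ℝ :=
  (2 * Real.pi / (2 * p / (p - 2) - 2)) ^ ((p - 2) / (2 * p)) + 2 * Real.pi + 1

theorem levelConst_pos {p : ℝ} (hp : 2 < p) : 0 < levelConst p := by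
  have hq2 : 0 < 2 * p / (p - 2) - 2 := by
    rw [sub_pos, lt_div_iff₀ (by linarith)]; linarith
  unfold levelConst
  positivity

/-- Markov's inequality for the remaining near part, whose `L¹` norm is computed by Tonelli. Keeping
the truncation of `f` at a height depending on `t`, rather than a plain weak-type bound, is what
lets the estimate be integrated in `t` to a strong one. -/
theorem volume_lt_cauchyPot_le {p : ℝ} (hp : 2 < p) {f : ℂ → ℝ≥0∞} (hf : Measurable f)
    (hf1 : ∫⁻ w, f w ^ (2 * p / (p + 2)) ≤ 1) {t : ℝ} (ht : 0 < t) :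
    volume {z | ENNReal.ofReal t < cauchyPot f z / ENNReal.ofReal (levelConst p)} ≤
      ENNReal.ofReal (2 * Real.pi * t ^ (-p / 2 - 1)) *
        ∫⁻ w, {w | ENNReal.ofReal (t ^ (1 + p / 2)) < f w}.indicator f w := by
  have hD := levelConst_pos hp
  have hset : MeasurableSet {w | ENNReal.ofReal (t ^ (1 + p / 2)) < f w} :=
    measurableSet_lt measurable_const hf
  have hg : Measurable ({w | ENNReal.ofReal (t ^ (1 + p / 2)) < f w}.indicator f) :=
    hf.indicator hset
  set N := fun z => ∫⁻ w, nearKernel (t ^ (-p / 2)) (z - w) *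
    {w | ENNReal.ofReal (t ^ (1 + p / 2)) < f w}.indicator f w with hN
  have hNm : Measurable N := Measurable.lintegral_prod_right'
    (f := fun x : ℂ × ℂ => nearKernel (t ^ (-p / 2)) (x.1 - x.2) *
      {w | ENNReal.ofReal (t ^ (1 + p / 2)) < f w}.indicator f x.2)
    (((measurable_nearKernel _).comp (by fun_prop)).mul (by fun_prop))
  -- The other contributions total at most `(levelConst p - 1) * t`, so the extra `1` in the
  -- constant leaves at least `t` for `N`.
  have hsub : {z | ENNReal.ofReal t < cauchyPot f z / ENNReal.ofReal (levelConst p)} ⊆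
      {z | ENNReal.ofReal t ≤ N z} := by
    intro z hz
    have hz' : ENNReal.ofReal t < cauchyPot f z / ENNReal.ofReal (levelConst p) := hz
    rw [ENNReal.lt_div_iff_mul_lt (Or.inl (by simpa using hD)) (Or.inl (by simp)),
      ← ENNReal.ofReal_mul ht.le] at hz'
    by_contra hcon
    have hcon' : N z < ENNReal.ofReal t := not_le.1 hcon
    have h1 := cauchyPot_le_near hp hf hf1 ht z
    have hc : 0 ≤ (2 * Real.pi / (2 * p / (p - 2) - 2)) ^ ((p - 2) / (2 * p)) + 2 * Real.pi := by
      have hq2 : 0 < 2 * p / (p - 2) - 2 := by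
        rw [sub_pos, lt_div_iff₀ (by linarith)]; linarith
      positivity
    refine absurd (hz'.trans_le h1) (not_lt.2 ?_)
    refine (add_le_add_right hcon'.le _).trans ?_
    rw [← ENNReal.ofReal_add (by positivity) ht.le]
    refine ENNReal.ofReal_le_ofReal (le_of_eq ?_)
    unfold levelConst
    ring
  refine (measure_mono hsub).trans ?_
  have hmk := mul_meas_ge_le_lintegral (μ := volume) hNm (ENNReal.ofReal t)
  rw [hN, lintegral_lintegral_nearKernel _ hg] at hmk
  have hinv : ENNReal.ofReal t⁻¹ * ENNReal.ofReal t = 1 := by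
    rw [← ENNReal.ofReal_mul (by positivity), inv_mul_cancel₀ ht.ne', ENNReal.ofReal_one]
  calc volume {z | ENNReal.ofReal t ≤ N z}
      = ENNReal.ofReal t⁻¹ * (ENNReal.ofReal t * volume {z | ENNReal.ofReal t ≤ N z}) := by
        rw [← mul_assoc, hinv, one_mul]
    _ ≤ ENNReal.ofReal t⁻¹ * (ENNReal.ofReal (2 * Real.pi * t ^ (-p / 2)) *
          ∫⁻ w, {w | ENNReal.ofReal (t ^ (1 + p / 2)) < f w}.indicator f w) := by gcongr
    _ = _ := by
        rw [← mul_assoc, ← ENNReal.ofReal_mul (by positivity), Real.rpow_sub_one ht.ne']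
        congr 2
        ring

/-- The Hardy–Littlewood–Sobolev inequality for `cauchyPot`, normalised. -/
theorem lintegral_cauchyPot_rpow_le_of_le_one {p : ℝ} (hp : 2 < p) {f : ℂ → ℝ≥0∞}
    (hf : Measurable f) (hf1 : ∫⁻ w, f w ^ (2 * p / (p + 2)) ≤ 1) :
    ∫⁻ z, cauchyPot f z ^ p ≤
      ENNReal.ofReal (levelConst p) ^ p * ENNReal.ofReal p *
        (ENNReal.ofReal (2 * Real.pi) * ENNReal.ofReal (p / 2 - 1)⁻¹) := by
  have hD := levelConst_pos hp
  have hp0 : 0 < p := by linarith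
  have hD0 : ENNReal.ofReal (levelConst p) ≠ 0 := by simpa using hD
  have hJ := measurable_cauchyPot hf
  set G := fun z => cauchyPot f z / ENNReal.ofReal (levelConst p) with hG
  have hGm : Measurable G := hJ.div_const _
  have e1 : ∀ z, cauchyPot f z ^ p = ENNReal.ofReal (levelConst p) ^ p * ENNReal.ofReal p *
      ∫⁻ t in Set.Ioi (0 : ℝ), {t : ℝ | ENNReal.ofReal t < G z}.indicator
        (fun t => ENNReal.ofReal (t ^ (p - 1))) t := by
    intro z
    rw [lintegral_indicator_rpow hp0, ← mul_assoc, mul_assoc _ (ENNReal.ofReal p),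
      ← ENNReal.ofReal_mul hp0.le, mul_inv_cancel₀ hp0.ne', ENNReal.ofReal_one, mul_one,
      ← ENNReal.mul_rpow_of_nonneg _ _ hp0.le, hG]
    rw [ENNReal.mul_div_cancel hD0 ENNReal.ofReal_ne_top]
  have hm1 : Measurable fun x : ℂ × ℝ => {t : ℝ | ENNReal.ofReal t < G x.1}.indicator
      (fun t => ENNReal.ofReal (t ^ (p - 1))) x.2 := by
    have : (fun x : ℂ × ℝ => {t : ℝ | ENNReal.ofReal t < G x.1}.indicator
        (fun t => ENNReal.ofReal (t ^ (p - 1))) x.2) =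
        {x : ℂ × ℝ | ENNReal.ofReal x.2 < G x.1}.indicator
          fun x => ENNReal.ofReal (x.2 ^ (p - 1)) := rfl
    rw [this]
    exact Measurable.indicator (by fun_prop) (measurableSet_lt (by fun_prop) (by fun_prop))
  simp_rw [e1]
  rw [lintegral_const_mul _ (Measurable.lintegral_prod_right' hm1)]
  gcongr
  rw [lintegral_lintegral_swap hm1.aemeasurable]
  have hβ : 0 < 1 + p / 2 := by positivity
  have hα : 0 < p / 2 - 1 := by linarith
  -- The level set bound turns the weight `t ^ (p - 1)` into `t ^ (p/2 - 2)`, and the truncation of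
  -- `f` is reread as an upper limit on `t`, ready for a second layer cake with exponent `p/2 - 1`.
  have step : ∀ t ∈ Set.Ioi (0 : ℝ), ∫⁻ z, {t : ℝ | ENNReal.ofReal t < G z}.indicator
      (fun t => ENNReal.ofReal (t ^ (p - 1))) t ≤
      ENNReal.ofReal (2 * Real.pi) * ∫⁻ w, f w *
        {t : ℝ | ENNReal.ofReal t < f w ^ (1 + p / 2)⁻¹}.indicator
          (fun t => ENNReal.ofReal (t ^ (p / 2 - 1 - 1))) t := by
    intro t ht
    have ht' : 0 < t := ht
    have l1 : ∫⁻ z, {t : ℝ | ENNReal.ofReal t < G z}.indicator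
        (fun t => ENNReal.ofReal (t ^ (p - 1))) t =
        ENNReal.ofReal (t ^ (p - 1)) * volume {z | ENNReal.ofReal t < G z} := by
      rw [← lintegral_indicator_const (measurableSet_lt measurable_const hGm)]
      rfl
    rw [l1]
    refine (mul_le_mul_right (volume_lt_cauchyPot_le hp hf hf1 ht') _).trans (le_of_eq ?_)
    rw [← mul_assoc, ← ENNReal.ofReal_mul (by positivity)]
    have hpow : t ^ (p - 1) * (2 * Real.pi * t ^ (-p / 2 - 1)) =
        2 * Real.pi * t ^ (p / 2 - 1 - 1) := by
      rw [mul_left_comm, ← Real.rpow_add ht']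
      congr 2
      ring
    rw [hpow, ENNReal.ofReal_mul (by positivity), mul_assoc, ← lintegral_const_mul _
      (hf.indicator (measurableSet_lt measurable_const hf))]
    congr 1
    refine lintegral_congr fun w => ?_
    have hiff : ENNReal.ofReal t < f w ^ (1 + p / 2)⁻¹ ↔
        ENNReal.ofReal (t ^ (1 + p / 2)) < f w := by
      rw [ENNReal.lt_rpow_inv_iff hβ, ENNReal.ofReal_rpow_of_pos ht']
    simp only [Set.indicator_apply, Set.mem_ofPred_eq, hiff]
    split_ifs <;> simp [mul_comm]
  refine (setLIntegral_mono' measurableSet_Ioi step).trans ?_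
  have hm2 : Measurable fun x : ℝ × ℂ => f x.2 *
      {t : ℝ | ENNReal.ofReal t < f x.2 ^ (1 + p / 2)⁻¹}.indicator
          (fun t => ENNReal.ofReal (t ^ (p / 2 - 1 - 1))) x.1 := by
    have : (fun x : ℝ × ℂ => {t : ℝ | ENNReal.ofReal t < f x.2 ^ (1 + p / 2)⁻¹}.indicator
        (fun t => ENNReal.ofReal (t ^ (p / 2 - 1 - 1))) x.1) =
        {x : ℝ × ℂ | ENNReal.ofReal x.1 < f x.2 ^ (1 + p / 2)⁻¹}.indicator
          fun x => ENNReal.ofReal (x.1 ^ (p / 2 - 1 - 1)) := rfl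
    refine Measurable.mul (by fun_prop) ?_
    rw [this]
    exact Measurable.indicator (by fun_prop) (measurableSet_lt (by fun_prop) (by fun_prop))
  rw [lintegral_const_mul _ (Measurable.lintegral_prod_right' hm2)]
  gcongr
  rw [lintegral_lintegral_swap hm2.aemeasurable]
  -- The exponents close up: `1 + (p/2 - 1) / (1 + p/2) = 2p/(p+2)`.
  have step2 : ∀ w, ∫⁻ t in Set.Ioi (0 : ℝ), f w *
        {t : ℝ | ENNReal.ofReal t < f w ^ (1 + p / 2)⁻¹}.indicator
          (fun t => ENNReal.ofReal (t ^ (p / 2 - 1 - 1))) t =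
      ENNReal.ofReal (p / 2 - 1)⁻¹ * f w ^ (2 * p / (p + 2)) := by
    intro w
    rw [lintegral_const_mul _ (Measurable.indicator (by fun_prop)
      (measurableSet_lt (by fun_prop) measurable_const)), lintegral_indicator_rpow hα,
      ← ENNReal.rpow_mul, mul_left_comm]
    congr 1
    conv_lhs => enter [1]; rw [← ENNReal.rpow_one (f w)]
    rw [← ENNReal.rpow_add_of_nonneg _ _ (by positivity) (by positivity)]
    congr 1
    field_simp
    ring
  simp_rw [step2]
  rw [lintegral_const_mul _ (by fun_prop)]
  exact (mul_le_mul_right hf1 _).trans (mul_one _).le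

/-- The Hardy–Littlewood–Sobolev inequality for `cauchyPot`. -/
theorem exists_lintegral_cauchyPot_rpow_le {p : ℝ} (hp : 2 < p) :
    ∃ K : ℝ≥0∞, K ≠ ∞ ∧ ∀ f : ℂ → ℝ≥0∞, Measurable f →
      ∫⁻ w, f w ^ (2 * p / (p + 2)) ≠ ∞ →
      ∫⁻ z, cauchyPot f z ^ p ≤ K * (∫⁻ w, f w ^ (2 * p / (p + 2))) ^ ((p + 2) / 2) := by
  have hp0 : 0 < p := by linarith
  have hr0 : 0 < 2 * p / (p + 2) := by positivity
  refine ⟨ENNReal.ofReal (levelConst p) ^ p * ENNReal.ofReal p *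
    (ENNReal.ofReal (2 * Real.pi) * ENNReal.ofReal (p / 2 - 1)⁻¹), ?_, fun f hf hfin => ?_⟩
  · finiteness
  · set N := ∫⁻ w, f w ^ (2 * p / (p + 2)) with hN
    rcases eq_or_ne N 0 with h0 | h0
    · have hf0 : f =ᵐ[volume] 0 := by
        rw [hN, lintegral_eq_zero_iff (by fun_prop)] at h0
        filter_upwards [h0] with w hw
        simpa [hr0, hr0.not_gt] using hw
      have : ∀ z, cauchyPot f z = 0 := by
        intro z
        refine (lintegral_congr_ae ?_).trans lintegral_zero
        filter_upwards [hf0] with w hw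
        simp [hw]
      simp [this, hp0]
    -- `c` is the `L^(2p/(p+2))` norm of `f`; by homogeneity the normalised inequality is applied to
    -- `c⁻¹ * f`.
    · set c := N ^ ((p + 2) / (2 * p)) with hc
      have hc0 : c ≠ 0 := by
        rw [hc]; simp [h0, hfin]
      have hct : c ≠ ∞ := ENNReal.rpow_ne_top_of_nonneg (by positivity) hfin
      have hcr : c ^ (2 * p / (p + 2)) = N := by
        rw [hc, ← ENNReal.rpow_mul, show (p + 2) / (2 * p) * (2 * p / (p + 2)) = 1 by field_simp,
          ENNReal.rpow_one]
      have h1 : ∫⁻ w, (c⁻¹ * f w) ^ (2 * p / (p + 2)) ≤ 1 := by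
        simp_rw [ENNReal.mul_rpow_of_nonneg _ _ hr0.le]
        rw [lintegral_const_mul _ (by fun_prop), ENNReal.inv_rpow, hcr]
        exact (ENNReal.inv_mul_cancel h0 hfin).le
      have h2 := lintegral_cauchyPot_rpow_le_of_le_one hp (hf.const_mul c⁻¹) h1
      have h3 : ∀ z, cauchyPot f z = c * cauchyPot (fun w => c⁻¹ * f w) z := by
        intro z
        unfold cauchyPot
        rw [← lintegral_const_mul _ (by fun_prop)]
        refine lintegral_congr fun w => ?_
        rw [mul_left_comm c, ← mul_assoc c, ENNReal.mul_inv_cancel hc0 hct, one_mul]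
      simp_rw [h3, ENNReal.mul_rpow_of_nonneg _ _ hp0.le]
      rw [lintegral_const_mul _ ((measurable_cauchyPot (hf.const_mul c⁻¹)).pow_const _)]
      have h4 : c ^ p = N ^ ((p + 2) / 2) := by
        rw [hc, ← ENNReal.rpow_mul]
        congr 1
        field_simp
      rw [h4, mul_comm]
      gcongr

/-! ### The Cauchy transform and the Cauchy–Pompeiu formula. -/

/-- The fundamental solution of `∂̄`. -/
noncomputable def cauchyKernel (w : ℂ) : ℂ := ((Real.pi : ℂ) * w)⁻¹

/-- The solid Cauchy transform. -/
noncomputable def cauchyTransform (ψ : ℂ → ℂ) (z : ℂ) : ℂ :=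
  ∫ w, cauchyKernel w * ψ (z - w)

theorem measurable_cauchyKernel : Measurable cauchyKernel := by
  unfold cauchyKernel
  fun_prop

theorem enorm_cauchyKernel_le (w : ℂ) : ‖cauchyKernel w‖ₑ ≤ ‖w‖ₑ⁻¹ := by
  rcases eq_or_ne w 0 with rfl | hw
  · simp [cauchyKernel]
  · rw [cauchyKernel, enorm_inv (mul_ne_zero (by exact_mod_cast Real.pi_ne_zero) hw),
      ENNReal.inv_le_inv, enorm_mul]
    refine le_mul_of_one_le_left zero_le ?_
    rw [← ofReal_norm, Complex.norm_real, Real.norm_of_nonneg Real.pi_pos.le,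
      ENNReal.one_le_ofReal]
    linarith [Real.pi_gt_three]

theorem locallyIntegrable_cauchyKernel : LocallyIntegrable cauchyKernel := by
  rw [locallyIntegrable_iff]
  intro k hk
  obtain ⟨R, hR⟩ := hk.isBounded.subset_closedBall 0
  refine IntegrableOn.mono_set ?_ hR
  refine ⟨measurable_cauchyKernel.aestronglyMeasurable, ?_⟩
  have hb : ∫⁻ w in Metric.closedBall (0 : ℂ) R, ‖w‖ₑ⁻¹ = ENNReal.ofReal (2 * Real.pi * R) := by
    rw [← lintegral_nearKernel, ← lintegral_indicator measurableSet_closedBall]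
    rfl
  refine (lintegral_mono enorm_cauchyKernel_le).trans_lt ?_
  rw [hb]
  finiteness

theorem cauchyTransform_eq_convolution (ψ : ℂ → ℂ) :
    cauchyTransform ψ =
      convolution cauchyKernel ψ (ContinuousLinearMap.mul ℝ ℂ) volume := rfl

theorem contDiff_cauchyTransform {ψ : ℂ → ℂ} (hψ : ContDiff ℝ (⊤ : ℕ∞) ψ)
    (hc : HasCompactSupport ψ) : ContDiff ℝ (⊤ : ℕ∞) (cauchyTransform ψ) :=
  hc.contDiff_convolution_right (ContinuousLinearMap.mul ℝ ℂ) locallyIntegrable_cauchyKernel hψ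

theorem integrable_cauchyKernel_mul {ψ : ℂ → ℂ} (hψ : Continuous ψ) (hc : HasCompactSupport ψ)
    (z : ℂ) : Integrable fun w => cauchyKernel w * ψ (z - w) := by
  refine integrable_mul_of_hasCompactSupport locallyIntegrable_cauchyKernel
    (hψ.comp (by fun_prop)) ?_
  exact hc.comp_homeomorph (Homeomorph.subLeft z)

theorem dbarFun_cauchyTransform_eq {ψ : ℂ → ℂ} (hψ : ContDiff ℝ 1 ψ)
    (hc : HasCompactSupport ψ) (z : ℂ) :
    dbarFun (cauchyTransform ψ) z = cauchyTransform (dbarFun ψ) z := by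
  have h := (hc.hasFDerivAt_convolution_right (ContinuousLinearMap.mul ℝ ℂ)
    locallyIntegrable_cauchyKernel hψ z).fderiv
  have hf : ∀ v, fderiv ℝ (cauchyTransform ψ) z v =
      cauchyTransform (fun w => fderiv ℝ ψ w v) z := by
    intro v
    rw [cauchyTransform_eq_convolution, h]
    exact convolution_precompR_apply _ locallyIntegrable_cauchyKernel (hc.fderiv ℝ)
      (hψ.continuous_fderiv (by simp)) z v
  have hi : ∀ v, Integrable fun w => cauchyKernel w * fderiv ℝ ψ (z - w) v := fun v =>
    integrable_cauchyKernel_mul (ψ := fun w => fderiv ℝ ψ w v)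
      ((hψ.continuous_fderiv (by simp)).clm_apply continuous_const) (hc.fderiv_apply ℝ v) z
  rw [dbarFun, hf, hf]
  unfold cauchyTransform
  rw [← integral_const_mul, ← integral_add (hi _) ((hi _).const_mul _), ← integral_const_mul]
  refine integral_congr_ae (.of_forall fun w => ?_)
  simp only [dbarFun]
  ring

/-- The point `e^{iθ}` of the unit circle. -/
noncomputable def circlePt (θ : ℝ) : ℂ := (Real.cos θ : ℂ) + (Real.sin θ : ℂ) * Complex.I

theorem continuous_circlePt : Continuous circlePt := by
  unfold circlePt
  fun_prop

theorem norm_circlePt (θ : ℝ) : ‖circlePt θ‖ = 1 := by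
  rw [circlePt, Complex.ofReal_cos, Complex.ofReal_sin, ← Complex.exp_mul_I]
  exact Complex.norm_exp_ofReal_mul_I θ

theorem hasDerivAt_circlePt (θ : ℝ) : HasDerivAt circlePt (Complex.I * circlePt θ) θ := by
  have h1 := (Real.hasDerivAt_cos θ).ofReal_comp
  have h2 := (Real.hasDerivAt_sin θ).ofReal_comp
  have h3 := h1.add (h2.mul_const Complex.I)
  have e : ((-Real.sin θ : ℝ) : ℂ) + (Real.cos θ : ℂ) * Complex.I = Complex.I * circlePt θ := by
    rw [circlePt, Complex.ofReal_neg]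
    linear_combination (-(Real.sin θ : ℂ)) * Complex.I_mul_I
  rw [e] at h3
  exact h3

/-- This is `∂̄` in polar coordinates: the radial and angular directions form the frame `1, i`
rotated by `e^{iθ}`, which costs a factor `e^{-iθ}`. -/
theorem fderiv_circlePt_add (L : ℂ →L[ℝ] ℂ) (θ : ℝ) :
    L (circlePt θ) + Complex.I * L (Complex.I * circlePt θ) =
      (circlePt θ)⁻¹ * (L 1 + Complex.I * L Complex.I) := by
  have hne : circlePt θ ≠ 0 := by
    rw [← norm_ne_zero_iff, norm_circlePt]
    exact one_ne_zero
  have hL : ∀ a b : ℝ, L (a + b * Complex.I) = a * L 1 + b * L Complex.I := by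
    intro a b
    have : (a : ℂ) + b * Complex.I = a • (1 : ℂ) + b • Complex.I := by simp
    rw [this, map_add, map_smul, map_smul, Complex.real_smul, Complex.real_smul]
  have e1 : Complex.I * circlePt θ = ((-Real.sin θ : ℝ) : ℂ) + (Real.cos θ : ℂ) * Complex.I := by
    rw [circlePt, Complex.ofReal_neg]
    linear_combination (Real.sin θ : ℂ) * Complex.I_mul_I
  have e2 : L (circlePt θ) = Real.cos θ * L 1 + Real.sin θ * L Complex.I := hL _ _
  have h1 : (Real.cos θ : ℂ) ^ 2 + (Real.sin θ : ℂ) ^ 2 = 1 := by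
    exact_mod_cast Real.cos_sq_add_sin_sq θ
  rw [eq_inv_mul_iff_mul_eq₀ hne, e2, e1, hL, circlePt, Complex.ofReal_neg]
  linear_combination (L 1 + Complex.I * L Complex.I) * h1 -
    (Real.sin θ : ℂ) ^ 2 * L 1 * Complex.I_mul_I +
    (Real.cos θ : ℂ) * Real.sin θ * L Complex.I * Complex.I_mul_I

/-- The **Cauchy–Pompeiu formula** for compactly supported functions. -/
theorem cauchyTransform_dbarFun {ψ : ℂ → ℂ} (hψ : ContDiff ℝ 1 ψ)
    (hc : HasCompactSupport ψ) (z : ℂ) : cauchyTransform (dbarFun ψ) z = ψ z := by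
  have hfc : Continuous (fderiv ℝ ψ) := hψ.continuous_fderiv (by simp)
  obtain ⟨ρ, hρ⟩ : ∃ ρ : ℝ, ∀ w, ρ ≤ ‖w‖ → w ∉ tsupport ψ := by
    obtain ⟨ρ, hρ⟩ := hc.isCompact.isBounded.subset_ball 0
    exact ⟨ρ, fun w hw hw' => absurd (mem_ball_zero_iff.1 (hρ hw')) (not_lt.2 hw)⟩
  set A : ℝ := ρ + ‖z‖ with hA
  have hout : ∀ r θ : ℝ, A ≤ |r| → z - r * circlePt θ ∉ tsupport ψ := by
    intro r θ hr
    apply hρ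
    have h1 : ‖(r : ℂ) * circlePt θ‖ = |r| := by simp [norm_circlePt]
    have h2 := norm_sub_norm_le ((r : ℂ) * circlePt θ) z
    rw [norm_sub_rev] at h2
    linarith
  -- integrability of continuous functions vanishing for large radius
  have hint : ∀ H : ℝ × ℝ → ℂ, Continuous H → (∀ r θ, A ≤ |r| → H (r, θ) = 0) →
      IntegrableOn H (Set.Ioi (0 : ℝ) ×ˢ Set.Ioo (-Real.pi) Real.pi) := by
    intro H hH h0
    have h1 : IntegrableOn H (Set.Icc 0 A ×ˢ Set.Icc (-Real.pi) Real.pi) :=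
      hH.continuousOn.integrableOn_compact (isCompact_Icc.prod isCompact_Icc)
    refine IntegrableOn.of_forall_sdiff_eq_zero h1 (measurableSet_Ioi.prod measurableSet_Ioo) ?_
    rintro ⟨r, θ⟩ ⟨⟨hr, hθ⟩, hn⟩
    refine h0 r θ ?_
    by_contra hlt
    rw [not_le, abs_of_pos hr] at hlt
    exact hn ⟨⟨le_of_lt hr, hlt.le⟩, Set.Ioo_subset_Icc_self hθ⟩
  -- Up to sign, `H₁` is the radial derivative of `ψ (z - r e^{iθ})` and `H₂` its angular derivative
  -- divided by `r`. Integrating `H₁` in `r` first leaves `ψ z` for every `θ`; integrating `H₂` in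
  -- `θ` first gives `0` by periodicity.
  set H₁ : ℝ × ℝ → ℂ := fun p => fderiv ℝ ψ (z - p.1 * circlePt p.2) (circlePt p.2) with hH₁
  set H₂ : ℝ × ℝ → ℂ :=
    fun p => fderiv ℝ ψ (z - p.1 * circlePt p.2) (Complex.I * circlePt p.2) with hH₂
  have hcp : Continuous fun p : ℝ × ℝ => circlePt p.2 := continuous_circlePt.comp continuous_snd
  have hpt : Continuous fun p : ℝ × ℝ => z - p.1 * circlePt p.2 :=
    continuous_const.sub ((Complex.continuous_ofReal.comp continuous_fst).mul hcp)
  have hzero : ∀ r θ v, A ≤ |r| → fderiv ℝ ψ (z - (r : ℝ) * circlePt θ) v = 0 := by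
    intro r θ v hr
    rw [image_eq_zero_of_notMem_tsupport
      (fun h => hout r θ hr (tsupport_fderiv_subset ℝ h))]
    rfl
  have hI₁ := hint H₁ ((hfc.comp hpt).clm_apply hcp) fun r θ hr => hzero r θ _ hr
  have hI₂ := hint H₂ ((hfc.comp hpt).clm_apply (continuous_const.mul hcp))
    fun r θ hr => hzero r θ _ hr
  have hψd : ∀ w, HasFDerivAt ψ (fderiv ℝ ψ w) w := fun w =>
    (hψ.differentiable (by simp) w).hasFDerivAt
  have int₁ : ∫ p in Set.Ioi (0 : ℝ) ×ˢ Set.Ioo (-Real.pi) Real.pi, H₁ p = 2 * Real.pi * ψ z := by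
    rw [Measure.volume_eq_prod, ← setIntegral_prod_swap, setIntegral_prod]
    · have inner : ∀ θ, ∫ r in Set.Ioi (0 : ℝ), H₁ (r, θ) = ψ z := by
        intro θ
        have hline : ∀ r : ℝ, HasDerivAt (fun r : ℝ => z - r * circlePt θ) (-circlePt θ) r := by
          intro r
          simpa using ((hasDerivAt_id r).ofReal_comp.mul_const (circlePt θ)).const_sub z
        have hd : ∀ r : ℝ, deriv (fun r : ℝ => ψ (z - r * circlePt θ)) r = -H₁ (r, θ) := by
          intro r
          exact (((hψd _).comp_hasDerivAt r (hline r)).deriv).trans (map_neg _ _)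
        have hsm : ContDiff ℝ 1 fun r : ℝ => ψ (z - r * circlePt θ) :=
          hψ.comp (contDiff_const.sub (Complex.ofRealCLM.contDiff.mul contDiff_const))
        have hcs : HasCompactSupport fun r : ℝ => ψ (z - r * circlePt θ) := by
          refine HasCompactSupport.intro (isCompact_Icc (a := -A) (b := A)) fun r hr => ?_
          refine image_eq_zero_of_notMem_tsupport (hout r θ ?_)
          by_contra hlt
          exact hr (abs_le.1 (not_le.1 hlt).le)
        have h2 := hcs.integral_Ioi_deriv_eq hsm 0
        simp_rw [hd] at h2
        rw [integral_neg, neg_inj] at h2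
        simpa using h2
      simp only [Prod.swap_prod_mk, inner]
      rw [setIntegral_const, Real.volume_real_Ioo_of_le (by linarith [Real.pi_pos]),
        Complex.real_smul]
      push_cast
      ring
    · exact (hI₁ : IntegrableOn H₁ _ (volume.prod volume)).swap
  have int₂ : ∫ p in Set.Ioi (0 : ℝ) ×ˢ Set.Ioo (-Real.pi) Real.pi, H₂ p = 0 := by
    rw [Measure.volume_eq_prod, setIntegral_prod _ hI₂]
    refine setIntegral_eq_zero_of_forall_eq_zero fun r hr => ?_
    have hr0 : (r : ℂ) ≠ 0 := by exact_mod_cast (ne_of_gt hr)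
    have hd : ∀ θ : ℝ, HasDerivAt (fun θ : ℝ => -(r : ℂ)⁻¹ * ψ (z - r * circlePt θ))
        (H₂ (r, θ)) θ := by
      intro θ
      have h1 : HasDerivAt (fun θ : ℝ => z - r * circlePt θ)
          (-(r • (Complex.I * circlePt θ))) θ := by
        rw [Complex.real_smul]
        exact ((hasDerivAt_circlePt θ).const_mul (r : ℂ)).const_sub z
      have h2 := ((hψd _).comp_hasDerivAt θ h1).const_mul (-(r : ℂ)⁻¹)
      rw [map_neg, map_smul, Complex.real_smul, neg_mul_neg, inv_mul_cancel_left₀ hr0] at h2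
      exact h2
    have hcont : Continuous fun θ => H₂ (r, θ) :=
      ((hfc.comp hpt).clm_apply (continuous_const.mul hcp)).comp (by fun_prop)
    rw [← integral_Ioc_eq_integral_Ioo, ← intervalIntegral.integral_of_le
      (by linarith [Real.pi_pos]), intervalIntegral.integral_eq_sub_of_hasDerivAt
      (fun θ _ => hd θ) (hcont.intervalIntegrable _ _)]
    simp [circlePt]
  unfold cauchyTransform
  rw [← Complex.integral_comp_polarCoord_symm]
  have hset : polarCoord.target = Set.Ioi (0 : ℝ) ×ˢ Set.Ioo (-Real.pi) Real.pi := rfl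
  rw [hset]
  -- The Jacobian `r` cancels the singularity of the kernel, and the two factors `e^{-iθ}` agree.
  have e : ∀ p ∈ Set.Ioi (0 : ℝ) ×ˢ Set.Ioo (-Real.pi) Real.pi,
      p.1 • (cauchyKernel (Complex.polarCoord.symm p) *
        dbarFun ψ (z - Complex.polarCoord.symm p)) =
      (2 * Real.pi : ℂ)⁻¹ * (H₁ p + Complex.I * H₂ p) := by
    intro p hp
    have hp1 : (p.1 : ℂ) ≠ 0 := by
      have : (0 : ℝ) < p.1 := hp.1
      exact_mod_cast this.ne'
    have hpol : Complex.polarCoord.symm p = p.1 * circlePt p.2 := by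
      rw [Complex.polarCoord_symm_apply]; rfl
    rw [hpol]
    simp only [hH₁, hH₂]
    rw [fderiv_circlePt_add, cauchyKernel, dbarFun, Complex.real_smul]
    field_simp
  rw [setIntegral_congr_fun (measurableSet_Ioi.prod measurableSet_Ioo) e, integral_const_mul,
    integral_add hI₁ (hI₂.const_mul _), integral_const_mul, int₁, int₂]
  have : (Real.pi : ℂ) ≠ 0 := by exact_mod_cast Real.pi_ne_zero
  field_simp
  simp

/-! ### Decay, product rules and cutoffs. -/

theorem cauchyTransform_eq_integral_sub (ψ : ℂ → ℂ) (z : ℂ) :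
    cauchyTransform ψ z = ∫ w, cauchyKernel (z - w) * ψ w := by
  have := integral_sub_left_eq_self (fun w => cauchyKernel w * ψ (z - w)) volume z
  simpa [cauchyTransform] using this.symm

theorem norm_cauchyKernel_le {w : ℂ} {d : ℝ} (hd : 0 < d) (h : d ≤ ‖w‖) :
    ‖cauchyKernel w‖ ≤ d⁻¹ := by
  rw [cauchyKernel, norm_inv, norm_mul, Complex.norm_real, Real.norm_of_nonneg Real.pi_pos.le]
  refine inv_anti₀ hd ?_
  nlinarith [Real.pi_gt_three]

theorem exists_norm_cauchyTransform_le {ψ : ℂ → ℂ} (hψ : ContDiff ℝ (⊤ : ℕ∞) ψ)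
    (hc : HasCompactSupport ψ) : ∃ M : ℝ, ∀ z, ‖cauchyTransform ψ z‖ ≤ M / (1 + ‖z‖) := by
  obtain ⟨ρ, hρ0, hρ⟩ := hc.isCompact.isBounded.subset_closedBall_lt 0 0
  have hcont := (contDiff_cauchyTransform hψ hc).continuous
  obtain ⟨M₀, hM₀⟩ := (isCompact_closedBall (0 : ℂ) (2 * ρ + 1)).exists_bound_of_continuousOn
    hcont.continuousOn
  have hint : Integrable ψ := hψ.continuous.integrable_of_hasCompactSupport hc
  refine ⟨max (M₀ * (2 * ρ + 2)) (2 * ∫ w, ‖ψ w‖), fun z => ?_⟩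
  have hz0 : 0 < 1 + ‖z‖ := by positivity
  rw [le_div_iff₀ hz0]
  by_cases hz : ‖z‖ ≤ 2 * ρ + 1
  · refine le_max_of_le_left ?_
    have h1 := hM₀ z (by simpa using hz)
    exact mul_le_mul h1 (by linarith) hz0.le ((norm_nonneg _).trans h1)
  -- For `|z| > 2ρ + 1` and `|w| ≤ ρ` one has `|z - w| ≥ (1 + |z|)/2`, which bounds the kernel on
  -- the support of `ψ`.
  · refine le_max_of_le_right ?_
    rw [not_le] at hz
    have h1 : ‖cauchyTransform ψ z‖ ≤ ∫ w, ((1 + ‖z‖) / 2)⁻¹ * ‖ψ w‖ := by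
      rw [cauchyTransform_eq_integral_sub]
      refine norm_integral_le_of_norm_le (hint.norm.const_mul _) (.of_forall fun w => ?_)
      rw [norm_mul]
      by_cases hw : w ∈ tsupport ψ
      · gcongr
        refine norm_cauchyKernel_le (by positivity) ?_
        have h2 : ‖w‖ ≤ ρ := by simpa using hρ hw
        have h3 := norm_sub_norm_le z w
        linarith
      · simp [image_eq_zero_of_notMem_tsupport hw]
    rw [integral_const_mul] at h1
    calc ‖cauchyTransform ψ z‖ * (1 + ‖z‖)
        ≤ (((1 + ‖z‖) / 2)⁻¹ * ∫ w, ‖ψ w‖) * (1 + ‖z‖) := by gcongr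
      _ = 2 * ∫ w, ‖ψ w‖ := by field_simp

theorem dbarFun_mul {f g : ℂ → ℂ} {z : ℂ} (hf : DifferentiableAt ℝ f z)
    (hg : DifferentiableAt ℝ g z) :
    dbarFun (fun z => f z * g z) z = f z * dbarFun g z + dbarFun f z * g z := by
  have h := (hf.hasFDerivAt.mul hg.hasFDerivAt).fderiv
  have h' : fderiv ℝ (fun z => f z * g z) z = f z • fderiv ℝ g z + g z • fderiv ℝ f z := h
  simp only [dbarFun, h', add_apply, smul_apply,
    smul_eq_mul]
  ring

theorem dbarFun_exp_neg {b : ℂ → ℂ} {z : ℂ} (hb : DifferentiableAt ℝ b z) :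
    dbarFun (fun z => Complex.exp (-b z)) z = -(Complex.exp (-b z) * dbarFun b z) := by
  have h' : fderiv ℝ (fun z => Complex.exp (-b z)) z = Complex.exp (-b z) • -fderiv ℝ b z :=
    hb.hasFDerivAt.neg.cexp.fderiv
  simp only [dbarFun, h', neg_apply, smul_apply,
    smul_eq_mul]
  ring

/-- Smooth cutoff functions exhausting the plane with `∂̄`-derivatives decaying uniformly. -/
theorem exists_cutoff_seq : ∃ (χ : ℕ → ℂ → ℂ) (c : ℝ),
    (∀ n, ContDiff ℝ (⊤ : ℕ∞) (χ n)) ∧ (∀ n, HasCompactSupport (χ n)) ∧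
    (∀ n z, ‖χ n z‖ ≤ 1) ∧ (∀ n z, ‖dbarFun (χ n) z‖ ≤ c / (1 + ‖z‖)) ∧
    (∀ z, ∀ᶠ n in Filter.atTop, χ n z = 1) ∧
    (∀ z, ∀ᶠ n in Filter.atTop, dbarFun (χ n) z = 0) := by
  let B : ContDiffBump (0 : ℂ) := ⟨1, 2, one_pos, one_lt_two⟩
  let β : ℂ → ℂ := fun z => (B z : ℂ)
  have hβ : ContDiff ℝ (⊤ : ℕ∞) β := Complex.ofRealCLM.contDiff.comp B.contDiff
  have hβc : HasCompactSupport β := B.hasCompactSupport.comp_left (g := fun x : ℝ => (x : ℂ)) rfl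
  have hβ1 : ContDiff ℝ 1 β := hβ.of_le (by norm_cast)
  obtain ⟨c, hc⟩ : ∃ c : ℝ, ∀ y, (1 + ‖y‖) * ‖dbarFun β y‖ ≤ c := by
    have h1 : Continuous fun y => ((1 + ‖y‖ : ℝ) : ℂ) * dbarFun β y :=
      (by fun_prop : Continuous fun y : ℂ => ((1 + ‖y‖ : ℝ) : ℂ)).mul (continuous_dbarFun hβ1)
    obtain ⟨c, hc⟩ := h1.bounded_above_of_compact_support
      (HasCompactSupport.mul_left (hasCompactSupport_dbarFun hβc))
    refine ⟨c, fun y => ?_⟩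
    have := hc y
    rwa [norm_mul, Complex.norm_real, Real.norm_of_nonneg (by positivity)] at this
  have hbd : ∀ (n : ℕ) z, dbarFun (fun z => β (((n : ℝ) + 1)⁻¹ • z)) z =
      (((n : ℝ) + 1)⁻¹ : ℝ) * dbarFun β (((n : ℝ) + 1)⁻¹ • z) := by
    intro n z
    have h1 : HasFDerivAt (fun z : ℂ => ((n : ℝ) + 1)⁻¹ • z)
        (((n : ℝ) + 1)⁻¹ • ContinuousLinearMap.id ℝ ℂ) z :=
      (((n : ℝ) + 1)⁻¹ • ContinuousLinearMap.id ℝ ℂ).hasFDerivAt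
    have h2 : fderiv ℝ (fun z => β (((n : ℝ) + 1)⁻¹ • z)) z = _ :=
      ((hβ.differentiable (by simp) (((n : ℝ) + 1)⁻¹ • z)).hasFDerivAt.comp z h1).fderiv
    rw [dbarFun, dbarFun, h2]
    simp only [ContinuousLinearMap.comp_apply, smul_apply, ContinuousLinearMap.id_apply, map_smul]
    simp only [Complex.real_smul]
    ring
  have hev : ∀ z : ℂ, ∀ᶠ n : ℕ in Filter.atTop,
      ((n : ℝ) + 1)⁻¹ • z ∈ Metric.ball (0 : ℂ) B.rIn := by
    intro z
    filter_upwards [Filter.eventually_ge_atTop ⌈‖z‖⌉₊] with n hn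
    have h1 : ‖z‖ ≤ n := (Nat.le_ceil _).trans (by exact_mod_cast hn)
    rw [mem_ball_zero_iff, norm_smul, norm_inv, Real.norm_of_nonneg (by positivity),
      inv_mul_lt_iff₀ (by positivity)]
    change ‖z‖ < ((n : ℝ) + 1) * 1
    linarith
  refine ⟨fun n z => β (((n : ℝ) + 1)⁻¹ • z), c, fun n => hβ.comp (contDiff_const_smul _),
    fun n => hβc.comp_smul (by positivity), fun n z => ?_, fun n z => ?_, fun z => ?_, fun z => ?_⟩
  · rw [Complex.norm_real, Real.norm_of_nonneg B.nonneg]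
    exact B.le_one
  · rw [hbd, le_div_iff₀ (by positivity), norm_mul, Complex.norm_real,
      Real.norm_of_nonneg (by positivity)]
    refine le_trans ?_ (hc (((n : ℝ) + 1)⁻¹ • z))
    rw [mul_right_comm]
    gcongr
    rw [norm_smul, norm_inv, Real.norm_of_nonneg (by positivity : (0 : ℝ) ≤ n + 1), mul_add]
    gcongr
    rw [mul_one]
    exact inv_le_one_of_one_le₀ (by linarith [(Nat.cast_nonneg n : (0 : ℝ) ≤ n)])
  · filter_upwards [hev z] with n hn
    have := B.one_of_mem_closedBall (Metric.ball_subset_closedBall hn)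
    simp only [β, this, Complex.ofReal_one]
  · filter_upwards [hev z] with n hn
    rw [hbd]
    have h1 : β =ᶠ[nhds (((n : ℝ) + 1)⁻¹ • z)] fun _ => 1 := by
      filter_upwards [B.eventuallyEq_one_of_mem_ball hn] with y hy
      simp [β, hy]
    rw [dbarFun, h1.fderiv_eq]
    simp

/-- Hölder: in the plane `(1 + |z|)⁻²` lies in every `L^q` with `q > 1`. It supplies the dominating
function for the cutoff error in `integral_mul_gauge`. -/
theorem integrable_norm_mul_inv_one_add_norm_sq {p : ℝ} (hp : 1 < p) {v : ℂ → ℂ}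
    (hv : MemLp v (ENNReal.ofReal p)) :
    Integrable fun z => ‖v z‖ * ((1 + ‖z‖) ^ 2)⁻¹ := by
  have hconj := Real.HolderConjugate.conjExponent hp
  set q := p.conjExponent with hq
  have hq1 : 1 < q := hconj.symm.lt
  have hk : MemLp (fun z : ℂ => ((1 + ‖z‖) ^ 2)⁻¹) (ENNReal.ofReal q) := by
    have hm : Continuous fun z : ℂ => ((1 + ‖z‖) ^ 2)⁻¹ := by
      refine Continuous.inv₀ (by fun_prop) fun z => by positivity
    rw [← integrable_norm_rpow_iff hm.aestronglyMeasurable (by simp; linarith) (by simp),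
      ENNReal.toReal_ofReal (by linarith)]
    refine (integrable_one_add_norm (E := ℂ) (μ := volume) (r := 2 * q) ?_).congr
      (.of_forall fun z => ?_)
    · rw [Complex.finrank_real_complex]
      push_cast
      linarith
    · have h0 : (0 : ℝ) ≤ 1 + ‖z‖ := by positivity
      change (1 + ‖z‖) ^ (-(2 * q)) = ‖((1 + ‖z‖) ^ 2)⁻¹‖ ^ q
      rw [Real.norm_of_nonneg (by positivity), ← Real.rpow_natCast, ← Real.rpow_neg h0,
        ← Real.rpow_mul h0]
      congr 1
      push_cast
      ring
  have : (ENNReal.ofReal p).HolderConjugate (ENNReal.ofReal q) := hconj.ennrealOfReal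
  exact hv.norm.integrable_mul hk

/-! ### The `L²`–`L^p` estimate and duality. -/

theorem lintegral_mul_cauchyPot_comm {f g : ℂ → ℝ≥0∞} (hf : Measurable f) (hg : Measurable g) :
    ∫⁻ z, f z * cauchyPot g z = ∫⁻ w, cauchyPot f w * g w := by
  unfold cauchyPot
  have h1 : ∀ z, f z * ∫⁻ w, ‖z - w‖ₑ⁻¹ * g w = ∫⁻ w, f z * (‖z - w‖ₑ⁻¹ * g w) := fun z =>
    (lintegral_const_mul _ (by fun_prop)).symm
  have h2 : ∀ w, (∫⁻ z, ‖w - z‖ₑ⁻¹ * f z) * g w = ∫⁻ z, f z * (‖z - w‖ₑ⁻¹ * g w) := by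
    intro w
    rw [← lintegral_mul_const _ (by fun_prop)]
    refine lintegral_congr fun z => ?_
    rw [← enorm_neg, neg_sub]
    ring
  simp_rw [h1, h2]
  exact lintegral_lintegral_swap (by fun_prop)

/-- Since `1/2 + 1/p = (p+2)/(2p)`, Hölder puts the product in exactly the space that
Hardy–Littlewood–Sobolev maps back to `L^p`. So multiplication by an `L²` function followed by the
potential is bounded on `L^p`, with norm controlled by the `L²` norm. -/
theorem exists_lintegral_cauchyPot_mul_rpow_le {p : ℝ} (hp : 2 < p) :
    ∃ K : ℝ≥0∞, K ≠ ∞ ∧ ∀ f g : ℂ → ℝ≥0∞, Measurable f → Measurable g →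
      ∫⁻ w, f w ^ (2 : ℝ) ≠ ∞ → ∫⁻ w, g w ^ p ≠ ∞ →
      ∫⁻ z, cauchyPot (fun w => f w * g w) z ^ p ≤
        K * (((∫⁻ w, f w ^ (2 : ℝ)) ^ (1 / 2 : ℝ)) ^ p * ∫⁻ w, g w ^ p) := by
  obtain ⟨K, hK, h⟩ := exists_lintegral_cauchyPot_rpow_le hp
  refine ⟨K, hK, fun f g hf hg hf2 hgp => ?_⟩
  have hp0 : 0 < p := by linarith
  have hr0 : 0 < 2 * p / (p + 2) := by positivity
  have holder := ENNReal.lintegral_Lp_mul_le_Lq_mul_Lr (p := 2 * p / (p + 2)) (q := 2) (r := p)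
    hr0 (by rw [div_lt_iff₀ (by linarith)]; linarith) (by field_simp) volume
    hf.aemeasurable hg.aemeasurable
  have hfin : (∫⁻ w, (f w * g w) ^ (2 * p / (p + 2))) ^ (1 / (2 * p / (p + 2))) ≠ ∞ := by
    refine ne_top_of_le_ne_top ?_ holder
    exact ENNReal.mul_ne_top (ENNReal.rpow_ne_top_of_nonneg (by positivity) hf2)
      (ENNReal.rpow_ne_top_of_nonneg (by positivity) hgp)
  have hfin' : ∫⁻ w, (f w * g w) ^ (2 * p / (p + 2)) ≠ ∞ := by
    intro htop
    rw [htop, ENNReal.top_rpow_of_pos (by positivity)] at hfin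
    exact hfin rfl
  refine (h _ (hf.mul hg) hfin').trans ?_
  gcongr
  have e : (p + 2) / 2 = 1 / (2 * p / (p + 2)) * p := by field_simp
  rw [e, ENNReal.rpow_mul]
  refine (ENNReal.rpow_le_rpow holder hp0.le).trans (le_of_eq ?_)
  rw [ENNReal.mul_rpow_of_nonneg _ _ hp0.le, ← ENNReal.rpow_mul _ (1 / p),
    one_div_mul_cancel hp0.ne', ENNReal.rpow_one]

/-- The adjoint of the Cauchy transform. -/
noncomputable def adjointCauchyTransform (F : ℂ → ℂ) (w : ℂ) : ℂ :=
  ∫ z, F z * cauchyKernel (z - w)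

theorem enorm_adjointCauchyTransform_le (F : ℂ → ℂ) (w : ℂ) :
    ‖adjointCauchyTransform F w‖ₑ ≤ cauchyPot (fun z => ‖F z‖ₑ) w := by
  refine (enorm_integral_le_lintegral_enorm _).trans (lintegral_mono fun z => ?_)
  rw [enorm_mul, mul_comm, ← enorm_neg (w - z), neg_sub]
  gcongr
  exact enorm_cauchyKernel_le _

theorem memLp_adjointCauchyTransform {p : ℝ} (hp : 1 < p) {F : ℂ → ℂ} (hF : StronglyMeasurable F)
    (hJ : ∫⁻ z, cauchyPot (fun z => ‖F z‖ₑ) z ^ p ≠ ∞) :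
    MemLp (adjointCauchyTransform F) (ENNReal.ofReal p) := by
  have hp0 : 0 < p := by linarith
  have hm : StronglyMeasurable (adjointCauchyTransform F) :=
    StronglyMeasurable.integral_prod_right (f := fun w z => F z * cauchyKernel (z - w))
      ((hF.comp_measurable measurable_snd).mul
        (measurable_cauchyKernel.comp (measurable_snd.sub measurable_fst)).stronglyMeasurable)
  refine ⟨hm.aestronglyMeasurable, ?_⟩
  rw [eLpNorm_lt_top_iff_lintegral_rpow_enorm_lt_top (by simpa using hp0) (by simp),
    ENNReal.toReal_ofReal hp0.le]
  refine lt_of_le_of_lt (lintegral_mono fun z => ?_) hJ.lt_top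
  exact ENNReal.rpow_le_rpow (enorm_adjointCauchyTransform_le F z) hp0.le

/-- Fubini's theorem for the pairing of a function with a Cauchy transform. -/
theorem integral_mul_cauchyTransform {p : ℝ} (hp : 1 < p) {F ψ : ℂ → ℂ}
    (hF : StronglyMeasurable F) (hJ : ∫⁻ z, cauchyPot (fun z => ‖F z‖ₑ) z ^ p ≠ ∞)
    (hψ : Continuous ψ) (hc : HasCompactSupport ψ) :
    Integrable (fun z => F z * cauchyTransform ψ z) ∧
      ∫ z, F z * cauchyTransform ψ z = ∫ w, ψ w * adjointCauchyTransform F w := by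
  have hconj := Real.HolderConjugate.conjExponent hp
  have hψp : ∫⁻ w, ‖ψ w‖ₑ ^ p.conjExponent ≠ ∞ := by
    have h1 : MemLp ψ (ENNReal.ofReal p.conjExponent) := hψ.memLp_of_hasCompactSupport hc
    have h2 := (eLpNorm_lt_top_iff_lintegral_rpow_enorm_lt_top
      (by simpa using hconj.symm.pos) (by simp)).1 h1.2
    rw [ENNReal.toReal_ofReal hconj.symm.nonneg] at h2
    exact h2.ne
  have hFe : Measurable fun z => ‖F z‖ₑ := hF.enorm
  have hψe : Measurable fun z => ‖ψ z‖ₑ := hψ.measurable.enorm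
  have hfin : ∫⁻ z, ‖F z‖ₑ * cauchyPot (fun w => ‖ψ w‖ₑ) z < ∞ := by
    rw [lintegral_mul_cauchyPot_comm hFe hψe]
    refine (ENNReal.lintegral_mul_le_Lp_mul_Lq volume hconj
      (measurable_cauchyPot hFe).aemeasurable hψe.aemeasurable).trans_lt ?_
    exact ENNReal.mul_lt_top
      (ENNReal.rpow_lt_top_of_nonneg (one_div_nonneg.2 hconj.nonneg) hJ)
      (ENNReal.rpow_lt_top_of_nonneg (one_div_nonneg.2 hconj.symm.nonneg) hψp)
  have hmk : StronglyMeasurable fun x : ℂ × ℂ => F x.1 * (cauchyKernel (x.1 - x.2) * ψ x.2) :=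
    (hF.comp_measurable measurable_fst).mul
      ((measurable_cauchyKernel.comp (measurable_fst.sub measurable_snd)).stronglyMeasurable.mul
        (hψ.comp continuous_snd).stronglyMeasurable)
  have hint : Integrable (fun x : ℂ × ℂ => F x.1 * (cauchyKernel (x.1 - x.2) * ψ x.2))
      (volume.prod volume) := by
    refine ⟨hmk.aestronglyMeasurable, ?_⟩
    rw [hasFiniteIntegral_iff_enorm, lintegral_prod _ hmk.enorm.aemeasurable]
    refine lt_of_le_of_lt (lintegral_mono fun z => ?_) hfin
    rw [cauchyPot, ← lintegral_const_mul' _ _ enorm_ne_top]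
    refine lintegral_mono fun w => ?_
    rw [enorm_mul, enorm_mul]
    gcongr
    exact enorm_cauchyKernel_le _
  have e : ∀ z, ∫ w, F z * (cauchyKernel (z - w) * ψ w) = F z * cauchyTransform ψ z := by
    intro z
    rw [cauchyTransform_eq_integral_sub, integral_const_mul]
  refine ⟨hint.integral_prod_left.congr (.of_forall e), ?_⟩
  calc ∫ z, F z * cauchyTransform ψ z = ∫ z, ∫ w, F z * (cauchyKernel (z - w) * ψ w) := by
        simp_rw [e]
    _ = ∫ w, ∫ z, F z * (cauchyKernel (z - w) * ψ w) := integral_integral_swap hint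
    _ = _ := by
        refine integral_congr_ae (.of_forall fun w => ?_)
        simp only [adjointCauchyTransform]
        rw [← integral_const_mul]
        refine integral_congr_ae (.of_forall fun z => ?_)
        ring

theorem locallyIntegrable_mul_of_memLp {p : ℝ≥0∞} (hp : 2 ≤ p) {q u : ℂ → ℂ}
    (hq : MemLp q 2) (hu : MemLp u p) : LocallyIntegrable fun z => q z * u z := by
  have hT : ENNReal.HolderTriple 2 p (2⁻¹ + p⁻¹)⁻¹ := ⟨by rw [inv_inv]⟩
  refine (MemLp.mul' (p := 2) (q := p) (r := (2⁻¹ + p⁻¹)⁻¹) hu hq).locallyIntegrable ?_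
  rw [ENNReal.one_le_inv, ← ENNReal.inv_two_add_inv_two]
  gcongr

/-! ### The exponential gauge and the Liouville theorem. -/

theorem exists_norm_exp_neg_cauchyTransform_le {g : ℂ → ℂ} (hg : ContDiff ℝ (⊤ : ℕ∞) g)
    (hgc : HasCompactSupport g) : ∃ E : ℝ, ∀ z, ‖Complex.exp (-cauchyTransform g z)‖ ≤ E := by
  obtain ⟨M, hM⟩ := exists_norm_cauchyTransform_le hg hgc
  refine ⟨Real.exp M, fun z => (Complex.norm_exp_le_exp_norm _).trans ?_⟩
  rw [Real.exp_le_exp, norm_neg]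
  have h0 : 0 ≤ M := by simpa using (norm_nonneg _).trans (hM 0)
  exact (hM z).trans (div_le_self h0 (by linarith [norm_nonneg z]))

/-- Multiplying a solution of `∂̄ u = q u` by the exponential of a smooth Cauchy transform. -/
theorem integral_mul_gauge {p : ℝ} (hp : 2 < p) {u q g ψ : ℂ → ℂ}
    (hu : MemLp u (ENNReal.ofReal p)) (hq : MemLp q 2)
    (hweak : ∀ φ : ℂ → ℂ, ContDiff ℝ (⊤ : ℕ∞) φ → HasCompactSupport φ →
      ∫ z, u z * dbarFun φ z = -∫ z, q z * u z * φ z)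
    (hg : ContDiff ℝ (⊤ : ℕ∞) g) (hgc : HasCompactSupport g)
    (hψ : ContDiff ℝ (⊤ : ℕ∞) ψ) (hψc : HasCompactSupport ψ)
    (hI : Integrable fun z =>
      (q z - g z) * (Complex.exp (-cauchyTransform g z) * u z) * cauchyTransform ψ z) :
    ∫ z, ψ z * (Complex.exp (-cauchyTransform g z) * u z) =
      -∫ z, (q z - g z) * (Complex.exp (-cauchyTransform g z) * u z) * cauchyTransform ψ z := by
  have hp1 : 1 ≤ ENNReal.ofReal p := by simp; linarith
  have hp2 : 2 ≤ ENNReal.ofReal p := by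
    rw [← ENNReal.ofReal_ofNat]
    exact ENNReal.ofReal_le_ofReal hp.le
  have hone : ((1 : ℕ∞) : WithTop ℕ∞) ≤ ((⊤ : ℕ∞) : WithTop ℕ∞) := by norm_cast
  have hB := contDiff_cauchyTransform hg hgc
  have hΨ := contDiff_cauchyTransform hψ hψc
  have hexp : ContDiff ℝ (⊤ : ℕ∞) fun z => Complex.exp (-cauchyTransform g z) := hB.neg.cexp
  obtain ⟨E, hE⟩ := exists_norm_exp_neg_cauchyTransform_le hg hgc
  have hE0 : 0 ≤ E := (norm_nonneg _).trans (hE 0)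
  obtain ⟨M, hM⟩ := exists_norm_cauchyTransform_le hψ hψc
  have hM0 : 0 ≤ M := by simpa using (norm_nonneg _).trans (hM 0)
  obtain ⟨χ, c, hχs, hχc, hχ1, hχd, hχe, hχde⟩ := exists_cutoff_seq
  have hc0 : 0 ≤ c := by simpa using (norm_nonneg _).trans (hχd 0 0)
  set v : ℂ → ℂ := fun z => Complex.exp (-cauchyTransform g z) * u z with hvdef
  have hvb : ∀ z, ‖v z‖ ≤ E * ‖u z‖ := fun z => by
    rw [hvdef, norm_mul]
    gcongr
    exact hE z
  have hv : MemLp v (ENNReal.ofReal p) :=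
    hu.of_le_mul (hexp.continuous.aestronglyMeasurable.mul hu.1) (.of_forall hvb)
  -- The exponential replaces `q` by `q - g`, and `∂̄ (C ψ) = ψ` recovers the desired test function.
  -- `C ψ` need not have compact support, hence the cutoff.
  set φ : ℕ → ℂ → ℂ := fun n z =>
    Complex.exp (-cauchyTransform g z) * (χ n z * cauchyTransform ψ z) with hφdef
  have hφ : ∀ n, ContDiff ℝ (⊤ : ℕ∞) (φ n) := fun n => hexp.mul ((hχs n).mul hΨ)
  have hφc : ∀ n, HasCompactSupport (φ n) := fun n =>
    HasCompactSupport.mul_left (HasCompactSupport.mul_right (hχc n))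
  have hdφ : ∀ n z, dbarFun (φ n) z = Complex.exp (-cauchyTransform g z) *
      (χ n z * ψ z + dbarFun (χ n) z * cauchyTransform ψ z -
        g z * (χ n z * cauchyTransform ψ z)) := by
    intro n z
    have dB := hB.differentiable (by simp) z
    have dΨ := hΨ.differentiable (by simp) z
    have dχ := (hχs n).differentiable (by simp) z
    have e1 := dbarFun_mul (hexp.differentiable (by simp) z) (dχ.mul dΨ)
    have e2 := dbarFun_mul dχ dΨ
    have e3 : dbarFun (cauchyTransform ψ) z = ψ z := by
      rw [dbarFun_cauchyTransform_eq (hψ.of_le hone) hψc, cauchyTransform_dbarFun (hψ.of_le hone) hψc]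
    have e4 : dbarFun (cauchyTransform g) z = g z := by
      rw [dbarFun_cauchyTransform_eq (hg.of_le hone) hgc, cauchyTransform_dbarFun (hg.of_le hone) hgc]
    have e5 := dbarFun_exp_neg dB
    rw [e4] at e5
    rw [e3] at e2
    refine e1.trans ?_
    rw [e5]
    refine (congrArg (fun x => _ * x + _) e2).trans ?_
    simp only [Pi.mul_apply]
    ring
  set G : ℕ → ℂ → ℂ := fun n z => u z * dbarFun (φ n) z + q z * u z * φ n z with hGdef
  have hGe : ∀ n z, G n z = χ n z * (ψ z * v z) +
      dbarFun (χ n) z * (cauchyTransform ψ z * v z) +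
      χ n z * ((q z - g z) * v z * cauchyTransform ψ z) := by
    intro n z
    simp only [hGdef, hdφ]
    simp only [hφdef, hvdef]
    ring
  have hi1 : ∀ n, Integrable fun z => u z * dbarFun (φ n) z := fun n =>
    integrable_mul_of_hasCompactSupport (hu.locallyIntegrable hp1)
      (continuous_dbarFun ((hφ n).of_le hone)) (hasCompactSupport_dbarFun (hφc n))
  have hi2 : ∀ n, Integrable fun z => q z * u z * φ n z := fun n =>
    integrable_mul_of_hasCompactSupport (locallyIntegrable_mul_of_memLp hp2 hq hu)
      (hφ n).continuous (hφc n)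
  have hG0 : ∀ n, ∫ z, G n z = 0 := fun n => by
    rw [hGdef, integral_add (hi1 n) (hi2 n), hweak _ (hφ n) (hφc n), neg_add_cancel]
  have hiψ : Integrable fun z => ψ z * v z := by
    simpa [mul_comm] using integrable_mul_of_hasCompactSupport (hv.locallyIntegrable hp1)
      hψ.continuous hψc
  have hiv := integrable_norm_mul_inv_one_add_norm_sq (by linarith) hv
  -- The term with `∂̄ χₙ` tends to `0` pointwise and is dominated by `c M |v| (1 + |z|)⁻²`.
  have hlim : Filter.Tendsto (fun n => ∫ z, G n z) Filter.atTop
      (nhds (∫ z, (ψ z * v z + (q z - g z) * v z * cauchyTransform ψ z))) := by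
    refine tendsto_integral_of_dominated_convergence
      (fun z => ‖ψ z * v z‖ + c * M * (‖v z‖ * ((1 + ‖z‖) ^ 2)⁻¹) +
        ‖(q z - g z) * v z * cauchyTransform ψ z‖)
      (fun n => ((hi1 n).add (hi2 n)).aestronglyMeasurable)
      ((hiψ.norm.add (hiv.const_mul _)).add hI.norm) (fun n => .of_forall fun z => ?_)
      (.of_forall fun z => ?_)
    · rw [hGe]
      refine (norm_add_le _ _).trans (add_le_add ((norm_add_le _ _).trans (add_le_add ?_ ?_)) ?_)
      · rw [norm_mul]
        exact mul_le_of_le_one_left (norm_nonneg _) (hχ1 n z)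
      · rw [norm_mul, norm_mul]
        calc ‖dbarFun (χ n) z‖ * (‖cauchyTransform ψ z‖ * ‖v z‖)
            ≤ c / (1 + ‖z‖) * (M / (1 + ‖z‖) * ‖v z‖) := by
              gcongr
              · exact hχd n z
              · exact hM z
          _ = _ := by
              have : (1 + ‖z‖) ≠ 0 := by positivity
              field_simp
      · rw [norm_mul]
        exact mul_le_of_le_one_left (norm_nonneg _) (hχ1 n z)
    · refine tendsto_const_nhds.congr' ?_
      filter_upwards [hχe z, hχde z] with n h1 h2
      rw [hGe, h1, h2]
      ring
  simp_rw [hG0] at hlim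
  have h0 := tendsto_nhds_unique tendsto_const_nhds hlim
  rw [integral_add hiψ hI] at h0
  linear_combination -h0

/-- The Liouville theorem for `∂̄ u = q u` with `q ∈ L²`. -/
theorem ae_eq_zero_of_weak_dbar_eq_mul {p : ℝ} (hp : 2 < p) {u q : ℂ → ℂ}
    (hum : StronglyMeasurable u) (hqm : StronglyMeasurable q)
    (hu : MemLp u (ENNReal.ofReal p)) (hq : MemLp q 2)
    (hweak : ∀ φ : ℂ → ℂ, ContDiff ℝ (⊤ : ℕ∞) φ → HasCompactSupport φ →
      ∫ z, u z * dbarFun φ z = -∫ z, q z * u z * φ z) :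
    u =ᵐ[volume] 0 := by
  have hp0 : 0 < p := by linarith
  have hp1 : 1 ≤ ENNReal.ofReal p := by simp; linarith
  obtain ⟨K, hK, hHLS⟩ := exists_lintegral_cauchyPot_mul_rpow_le hp
  obtain ⟨ε, hε0, hε⟩ : ∃ ε : ℝ, 0 < ε ∧ K * ENNReal.ofReal ε ^ p < 1 := by
    -- With this `ε`, `K ε^p = K/(K + 1) < 1`.
    refine ⟨((K.toReal + 1)⁻¹) ^ p⁻¹, by positivity, ?_⟩
    rw [ENNReal.ofReal_rpow_of_nonneg (by positivity) hp0.le, ← Real.rpow_mul (by positivity),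
      inv_mul_cancel₀ hp0.ne', Real.rpow_one, ← ENNReal.ofReal_toReal hK,
      ← ENNReal.ofReal_mul (by positivity), ENNReal.ofReal_lt_one,
      ENNReal.toReal_ofReal (by positivity), ← div_eq_mul_inv, div_lt_one (by positivity)]
    linarith
  obtain ⟨g, hgc, hg, hgε⟩ := hq.exist_eLpNorm_sub_le (by simp) (by simp) hε0
  set v : ℂ → ℂ := fun z => Complex.exp (-cauchyTransform g z) * u z with hvdef
  have hexp : Continuous fun z => Complex.exp (-cauchyTransform g z) :=
    (contDiff_cauchyTransform hg hgc).continuous.neg.cexp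
  obtain ⟨E, hE⟩ := exists_norm_exp_neg_cauchyTransform_le hg hgc
  have hvm : StronglyMeasurable v := hexp.stronglyMeasurable.mul hum
  have hv : MemLp v (ENNReal.ofReal p) := by
    refine hu.of_le_mul (c := E) hvm.aestronglyMeasurable (.of_forall fun z => ?_)
    rw [hvdef, norm_mul]
    gcongr
    exact hE z
  set V := ∫⁻ z, ‖v z‖ₑ ^ p with hV
  have hVfin : V ≠ ∞ := by
    have h2 := (eLpNorm_lt_top_iff_lintegral_rpow_enorm_lt_top (by simpa using hp0) (by simp)).1 hv.2
    rw [ENNReal.toReal_ofReal hp0.le] at h2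
    exact h2.ne
  have hsm : StronglyMeasurable fun z => q z - g z := hqm.sub hg.continuous.stronglyMeasurable
  have hA : (∫⁻ z, ‖q z - g z‖ₑ ^ (2 : ℝ)) ^ (1 / 2 : ℝ) ≤ ENNReal.ofReal ε := by
    rw [eLpNorm_eq_lintegral_rpow_enorm_toReal (by simp) (by simp)] at hgε
    simpa using hgε
  have hAfin : ∫⁻ z, ‖q z - g z‖ₑ ^ (2 : ℝ) ≠ ∞ := by
    intro htop
    rw [htop, ENNReal.top_rpow_of_pos (by norm_num)] at hA
    exact absurd hA (by simp)
  set F : ℂ → ℂ := fun z => (q z - g z) * v z with hFdef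
  have hF : StronglyMeasurable F := hsm.mul hvm
  have hJle : ∫⁻ z, cauchyPot (fun z => ‖F z‖ₑ) z ^ p ≤ K * (ENNReal.ofReal ε ^ p * V) := by
    have h1 := hHLS _ _ hsm.enorm hvm.enorm hAfin hVfin
    simp only [hFdef, enorm_mul]
    refine h1.trans ?_
    gcongr
  have hJ : ∫⁻ z, cauchyPot (fun z => ‖F z‖ₑ) z ^ p ≠ ∞ := by
    refine ne_top_of_le_ne_top ?_ hJle
    finiteness
  -- The kernel is odd, so the right side is the Cauchy transform of `F = (q - g) v`. The identity
  -- is checked against test functions, the transform being moved across by Fubini.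
  have hrep : ∀ᵐ z, v z = -adjointCauchyTransform F z := by
    refine ae_eq_of_integral_contDiff_smul_eq (hv.locallyIntegrable hp1)
      ((memLp_adjointCauchyTransform (by linarith) hF hJ).neg.locallyIntegrable hp1)
      fun ψ hψ hψc => ?_
    have hψ' : ContDiff ℝ (⊤ : ℕ∞) fun z => (ψ z : ℂ) := Complex.ofRealCLM.contDiff.comp hψ
    have hψc' : HasCompactSupport fun z => (ψ z : ℂ) :=
      hψc.comp_left (g := fun x : ℝ => (x : ℂ)) (by simp)
    obtain ⟨hI, hfub⟩ := integral_mul_cauchyTransform (by linarith) hF hJ hψ'.continuous hψc'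
    have hid := integral_mul_gauge hp hu hq hweak hg hgc hψ' hψc' hI
    rw [hfub] at hid
    simp only [Complex.real_smul]
    rw [hid, ← integral_neg]
    simp
  have hVle : V ≤ K * ENNReal.ofReal ε ^ p * V := by
    rw [mul_assoc]
    refine le_trans (lintegral_mono_ae ?_) hJle
    filter_upwards [hrep] with z hz
    rw [hz, enorm_neg]
    exact ENNReal.rpow_le_rpow (enorm_adjointCauchyTransform_le F z) hp0.le
  -- Finiteness of `V` is essential here: `V ≤ θ V` with `θ < 1` says nothing about `V = ∞`.
  have hV0 : V = 0 := by
    by_contra hne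
    have h1 := ENNReal.mul_lt_mul_left hne hVfin hε
    rw [one_mul] at h1
    exact absurd hVle (not_le.2 h1)
  rw [hV, lintegral_eq_zero_iff (hvm.enorm.pow_const p)] at hV0
  filter_upwards [hV0] with z hz
  have h1 : ‖v z‖ₑ = 0 := by simpa [hp0, hp0.not_gt] using hz
  rw [enorm_eq_zero, hvdef] at h1
  exact (mul_eq_zero.1 h1).resolve_left (Complex.exp_ne_zero _)

/-! ### Reduction to the complex-linear equation. -/

theorem mainTheorem8 (p : ℝ≥0∞) (hp : 2 < p) (hp' : p ≠ ∞) (a u : ℂ → ℂ)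
    (ha : MemLp a 2 (volume : Measure ℂ)) (hu : MemLp u p (volume : Measure ℂ))
    (h : dbar (distOfFun u) = distOfFun (fun z => a z * conj (u z))) :
    u =ᵐ[(volume : Measure ℂ)] 0 := by
  have hpr : ENNReal.ofReal p.toReal = p := ENNReal.ofReal_toReal hp'
  have hp2 : 2 < p.toReal := by
    have := (ENNReal.toReal_lt_toReal (by simp) hp').2 hp
    simpa using this
  obtain ⟨u₁, hu₁m, hu₁⟩ := hu.1
  obtain ⟨a₁, ha₁m, ha₁⟩ := ha.1
  have hu₁L : MemLp u₁ p := hu.ae_eq hu₁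
  have ha₁L : MemLp a₁ 2 := ha.ae_eq ha₁
  have hconj : MemLp (fun z => conj (u z)) p := by
    refine hu.of_le (Complex.continuous_conj.comp_aestronglyMeasurable hu.1) (.of_forall fun z => ?_)
    simp
  -- Where `u₁` vanishes, division by zero gives `q = 0`, and `q u₁ = a₁ conj u₁` still holds there.
  set q : ℂ → ℂ := fun z => a₁ z * (conj (u₁ z) / u₁ z) with hq
  have hqu : ∀ z, q z * u₁ z = a₁ z * conj (u₁ z) := by
    intro z
    by_cases hz : u₁ z = 0
    · simp [hz]
    · simp only [hq]
      field_simp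
  have hqm : StronglyMeasurable q := by
    have := hu₁m.measurable
    have := ha₁m.measurable
    exact Measurable.stronglyMeasurable (by fun_prop)
  have hqL : MemLp q 2 := by
    refine ha₁L.of_le hqm.aestronglyMeasurable (.of_forall fun z => ?_)
    rw [hq, norm_mul, norm_div, RCLike.norm_conj]
    exact mul_le_of_le_one_right (norm_nonneg _) (div_self_le_one _)
  refine hu₁.trans (ae_eq_zero_of_weak_dbar_eq_mul hp2 hu₁m hqm (hpr.symm ▸ hu₁L) hqL ?_)
  intro φ hφ hφc
  have key := integral_mul_dbarFun_of_dbar_eq (hu.locallyIntegrable (one_le_two.trans hp.le))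
    (locallyIntegrable_mul_of_memLp hp.le ha hconj) h hφ hφc
  have e1 : ∫ z, u₁ z * dbarFun φ z = ∫ z, u z * dbarFun φ z := by
    refine integral_congr_ae ?_
    filter_upwards [hu₁] with z hz
    rw [hz]
  have e2 : ∫ z, q z * u₁ z * φ z = ∫ z, a z * conj (u z) * φ z := by
    refine integral_congr_ae ?_
    filter_upwards [hu₁, ha₁] with z hz1 hz2
    rw [hqu, hz1, hz2]
  rw [e1, e2, key]
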